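/- Let $b>0$ and let $\theta:[0,b]\to\mathbb R$ be a smooth function (smooth up to the end points) with $\theta^{-1}\{0\}=\{0\}$ and $\theta^{-1}\{\pi/2\}=\{b\}$. Regard $$g = dx^2+\sin^2\theta(x)\,dy^2+\cos^2\theta(x)\,dz^2$$ as a Riemannian metric on $(0,b)\times S^1\times S^1$, where $y$ and $z$ are the angular coordinates of period $2\pi$ on the two circles, and identify $(0,b)\times S^1\times S^1$ with the complement of two great circles in the unit sphere $\mathbb S^3\subset\mathbb C^2$ by $$(x,y,z)\mapsto\Bigl(\sin\tfrac{\pi x}{2b}\,e^{iy},\ \cos\tfrac{\pi x}{2b}\,e^{iz}\Bigr),$$ so that the $y$-circles collapse at $x=0$, around which $(x,y)$ are polar coordinates, and the $z$-circles collapse at $x=b$, around which $(b-x,z)$ are polar coordinates. Then $g$ defines a smooth metric on $\mathbb S^3$, that is, there is a smooth ($C^\infty$) Riemannian metric on $\mathbb S^3$ which coincides with $g$ on $(0,b)\times S^1\times S^1$, if and only if $$\theta'(0)=\theta'(b)=1\quad\text{and}\quad \theta^{(2k)}(0)=\theta^{(2k)}(b)=0\ \text{ for every integer } k\ge 1,$$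 where the derivatives at the end points are one-sided. -/

import Mathlib

open scoped Manifold ContDiff Bundle

noncomputable section

/-- The unit sphere of `ℝ⁴` (Mathlib gives it its standard smooth structure, modelled on `ℝ³`). -/
abbrev S3 : Type := Metric.sphere (0 : EuclideanSpace ℝ (Fin 4)) 1

/-- The map `(x, y, z) ↦ (sin s e^{iy}, cos s e^{iz})`, with `s = π x / (2 b)`, from `ℝ × ℝ × ℝ`
to `ℝ⁴ = ℂ × ℂ`. -/
def joinVec (b : ℝ) (q : ℝ × ℝ × ℝ) : EuclideanSpace ℝ (Fin 4) :=
  !₂[Real.sin (Real.pi * q.1 / (2 * b)) * Real.cos q.2.1,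
     Real.sin (Real.pi * q.1 / (2 * b)) * Real.sin q.2.1,
     Real.cos (Real.pi * q.1 / (2 * b)) * Real.cos q.2.2,
     Real.cos (Real.pi * q.1 / (2 * b)) * Real.sin q.2.2]

theorem joinVec_mem (b : ℝ) (q : ℝ × ℝ × ℝ) :
    joinVec b q ∈ Metric.sphere (0 : EuclideanSpace ℝ (Fin 4)) 1 := by
  rw [mem_sphere_zero_iff_norm, EuclideanSpace.norm_eq, Real.sqrt_eq_one]
  simp only [joinVec, Fin.sum_univ_four, Real.norm_eq_abs, sq_abs]
  simp
  nlinarith [Real.sin_sq_add_cos_sq q.2.1, Real.sin_sq_add_cos_sq q.2.2,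
    Real.sin_sq_add_cos_sq (Real.pi * q.1 / (2 * b)),
    congrArg (fun t => Real.sin (Real.pi * q.1 / (2 * b)) ^ 2 * t)
      (Real.sin_sq_add_cos_sq q.2.1),
    congrArg (fun t => Real.cos (Real.pi * q.1 / (2 * b)) ^ 2 * t)
      (Real.sin_sq_add_cos_sq q.2.2)]

/-- The coordinates `(x, y, z)` on `S³`, where `y` and `z` are angles (of period `2π`). On
`(0, b) × (ℝ/2πℤ) × (ℝ/2πℤ)` this is a diffeomorphism onto the complement of two great circles.
The `y`-circles collapse at `x = 0`, around which `(x, y)` are polar coordinates, and the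
`z`-circles collapse at `x = b`, around which `(b - x, z)` are polar coordinates. -/
def joinCoord (b : ℝ) (q : ℝ × ℝ × ℝ) : S3 := ⟨joinVec b q, joinVec_mem b q⟩

/-- The metric `dx² + sin² θ(x) dy² + cos² θ(x) dz²` at the point `q = (x, y, z)`. -/
def coordMetric (θ : ℝ → ℝ) (q v w : ℝ × ℝ × ℝ) : ℝ :=
  v.1 * w.1 + Real.sin (θ q.1) ^ 2 * (v.2.1 * w.2.1) + Real.cos (θ q.1) ^ 2 * (v.2.2 * w.2.2)

/-- Smooth Riemannian metrics on `S³`. -/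
abbrev SmoothMetricS3 : Type :=
  Bundle.ContMDiffRiemannianMetric (𝓡 3) ∞ (EuclideanSpace ℝ (Fin 3))
    (fun p : S3 => TangentSpace (𝓡 3) p)

/-- The metric `dx² + sin² θ(x) dy² + cos² θ(x) dz²`, `0 < x < b`, defines a smooth metric on `S³`:
there is a smooth Riemannian metric on the whole of `S³` that is equal to it in the coordinates
`(x, y, z)` on the domain `0 < x < b` of these coordinates. -/
def DefinesSmoothMetricS3 (b : ℝ) (θ : ℝ → ℝ) : Prop :=
  ∃ G : SmoothMetricS3, ∀ q : ℝ × ℝ × ℝ, q.1 ∈ Set.Ioo 0 b → ∀ v w : ℝ × ℝ × ℝ,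
    G.inner (joinCoord b q)
      (mfderiv 𝓘(ℝ, ℝ × ℝ × ℝ) (𝓡 3) (joinCoord b) q v)
      (mfderiv 𝓘(ℝ, ℝ × ℝ × ℝ) (𝓡 3) (joinCoord b) q w) = coordMetric θ q v w

end

/-! Put `s = πx/2b`, `t = sin² s = |p₀|² + |p₁|²` and `c = (2b/π)²`, so that `c` times the round
metric is `dx² + c t dy² + c (1 - t) dz²`. The rotation one-form `ω₀₁ = p₀ dp₁ - p₁ dp₀` restricts
to `t dy`, and `ω₂₃` to `(1 - t) dz`.

Sufficiency: if `θ` has an odd jet at `0` with `θ'(0) = 1`, then `sin² θ` is a smooth even function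
of `sin s` with leading term `c sin² s`. By Whitney's theorem `sin² θ = c t + t² α(t)` with `α`
smooth up to `t = 0`. The jet at `b` makes `α` smooth up to `t = 1`, and symmetrically `cos² θ = c
(1 - t) + (1 - t)² β(1 - t)`. Hence `g` is the restriction to the sphere of `c ⟨·,·⟩ + α(t) ω₀₁² +
β(1 - t) ω₂₃²`, which is smooth and positive definite on `ℝ⁴` at every point of the sphere. The
chain is `exists_sin_sq_expansion`, `exists_profile_of_isOddUnitJet`, `toralForm_pos`,
`exists_smoothMetricS3`, `toralForm_joinCoord`.

Necessity: along the great circle `(sin s, 0, cos s, 0)` evaluate the metric on the constant vector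
`e = (0, 1, 0, 0)`; the result `k(x)` is smooth through `x = 0`. Since `∂_y = sin s · e`, one gets
`sin² θ = sin² s · k`. The half `x < 0` is the same curve with `y = π`, so `k` is even. Along `y =
π/2` the unit vector `∂_x` tends to `(π/2b) e`, so `k(0) = c`. Then `θ = arcsin (sin s · √k)` near
`0` is odd with derivative `1`. This is `exists_even_factor` with `odd_jet_of_sin_sq_eq`; the end
`b` follows by replacing `θ(x)` with `π/2 - θ(b - x)`. -/

open Set Filter Topology Interval Bundle

/-! ### Hadamard's lemma and Whitney's theorem on even functions -/

/-- A pointwise derivative on a set with unique derivatives raises the order of smoothness. -/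
theorem ContDiffOn.succ_of_hasDerivWithinAt {s : Set ℝ} (hs : UniqueDiffOn ℝ s) {f f' : ℝ → ℝ}
    {n : ℕ} (hf : ∀ x ∈ s, HasDerivWithinAt f (f' x) s x) (hf' : ContDiffOn ℝ n f' s) :
    ContDiffOn ℝ (n + 1 : ℕ) f s := by
  push_cast
  rw [contDiffOn_succ_iff_derivWithin hs]
  refine ⟨fun x hx => (hf x hx).differentiableWithinAt, by simp, hf'.congr fun x hx => ?_⟩
  exact (hf x hx).derivWithin (hs x hx)

theorem mul_mem_Ioo_of_mem_Icc {a x s : ℝ} (hx : x ∈ Ioo (-a) a) (hs : s ∈ Icc (0 : ℝ) 1) :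
    s * x ∈ Ioo (-a) a := by
  obtain ⟨h1, h2⟩ := hx
  obtain ⟨h3, h4⟩ := hs
  constructor <;> rcases le_total 0 x with h | h <;> nlinarith

/-- The weight `s ^ k` makes this family of integrals closed under differentiation: `(k, f)` becomes
`(k + 1, f')`. Smoothness of all orders then follows by induction. -/
theorem hasDerivAt_integral_pow_mul_comp_mul {a : ℝ} {f f' : ℝ → ℝ} (k : ℕ)
    (hf : ∀ x ∈ Ioo (-a) a, HasDerivAt f (f' x) x) (hf' : ContinuousOn f' (Ioo (-a) a))
    {x : ℝ} (hx : x ∈ Ioo (-a) a) :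
    HasDerivAt (fun x => ∫ s in (0 : ℝ)..1, s ^ k * f (s * x))
      (∫ s in (0 : ℝ)..1, s ^ (k + 1) * f' (s * x)) x := by
  have hfc : ContinuousOn f (Ioo (-a) a) := fun y hy => (hf y hy).continuousAt.continuousWithinAt
  have hcont : ∀ (g : ℝ → ℝ) (j : ℕ), ContinuousOn g (Ioo (-a) a) → ∀ y ∈ Ioo (-a) a,
      ContinuousOn (fun s => s ^ j * g (s * y)) (uIcc (0 : ℝ) 1) := by
    intro g j hg y hy
    rw [uIcc_of_le zero_le_one]
    exact (continuous_id.pow j).continuousOn.mul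
      (hg.comp (by fun_prop) fun s hs => mul_mem_Ioo_of_mem_Icc hy hs)
  -- `f'` may be unbounded on the open interval; shrinking to `[-c, c]` gives a constant dominating
  -- function.
  obtain ⟨c, hc1, hc2⟩ : ∃ c, |x| < c ∧ c < a := exists_between (abs_lt.2 hx)
  have hsub : Icc (-c) c ⊆ Ioo (-a) a := fun y hy => ⟨by linarith [hy.1], by linarith [hy.2]⟩
  obtain ⟨M, hM⟩ := isCompact_Icc.exists_bound_of_continuousOn (hf'.mono hsub)
  have hΙ : Ι (0 : ℝ) 1 ⊆ uIcc 0 1 := uIoc_subset_uIcc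
  have hnhds : Ioo (-c) c ∈ 𝓝 x := Ioo_mem_nhds (abs_lt.1 hc1).1 (abs_lt.1 hc1).2
  refine (intervalIntegral.hasDerivAt_integral_of_dominated_loc_of_deriv_le (bound := fun _ => M)
    (F := fun x s => s ^ k * f (s * x)) (F' := fun x s => s ^ (k + 1) * f' (s * x))
    hnhds ?_ ?_ ?_ ?_ ?_ ?_).2
  · filter_upwards [hnhds] with y hy
    exact ((hcont f k hfc y (hsub ⟨hy.1.le, hy.2.le⟩)).mono hΙ).aestronglyMeasurable
      measurableSet_uIoc
  · exact (hcont f k hfc x hx).intervalIntegrable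
  · exact ((hcont f' (k + 1) hf' x hx).mono hΙ).aestronglyMeasurable measurableSet_uIoc
  · refine Eventually.of_forall fun s hs y hy => ?_
    rw [uIoc_of_le zero_le_one] at hs
    have h1 : ‖f' (s * y)‖ ≤ M :=
      hM _ (Ioo_subset_Icc_self (mul_mem_Ioo_of_mem_Icc hy ⟨hs.1.le, hs.2⟩))
    have h2 : ‖s ^ (k + 1)‖ ≤ 1 := by
      rw [norm_pow, Real.norm_of_nonneg hs.1.le]
      exact pow_le_one₀ hs.1.le hs.2
    rw [norm_mul]
    nlinarith [norm_nonneg (f' (s * y)), norm_nonneg (s ^ (k + 1))]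
  · simp
  · refine Eventually.of_forall fun s hs y hy => ?_
    rw [uIoc_of_le zero_le_one] at hs
    have h1 := hf _ (mul_mem_Ioo_of_mem_Icc (hsub ⟨hy.1.le, hy.2.le⟩) ⟨hs.1.le, hs.2⟩)
    have h2 : HasDerivAt (fun y : ℝ => s * y) s y := by
      simpa using (hasDerivAt_id y).const_mul s
    have h3 := (h1.comp y h2).const_mul (s ^ k)
    exact h3.congr_deriv (by ring)

theorem contDiffOn_deriv_Ioo {a b : ℝ} {f : ℝ → ℝ} (hf : ContDiffOn ℝ ∞ f (Ioo a b)) :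
    ContDiffOn ℝ ∞ (deriv f) (Ioo a b) :=
  ((contDiffOn_infty_iff_deriv_of_isOpen isOpen_Ioo).1 hf).2

theorem ContDiffOn.hasDerivAt_Ioo {a b : ℝ} {f : ℝ → ℝ} (hf : ContDiffOn ℝ ∞ f (Ioo a b)) {x : ℝ}
    (hx : x ∈ Ioo a b) : HasDerivAt f (deriv f x) x :=
  ((hf.differentiableOn (by simp)).differentiableAt (isOpen_Ioo.mem_nhds hx)).hasDerivAt

theorem contDiffOn_integral_pow_mul_comp_mul {a : ℝ} (n : ℕ) :
    ∀ (f : ℝ → ℝ) (k : ℕ), ContDiffOn ℝ ∞ f (Ioo (-a) a) →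
      ContDiffOn ℝ n (fun x => ∫ s in (0 : ℝ)..1, s ^ k * f (s * x)) (Ioo (-a) a) := by
  induction n with
  | zero =>
    intro f k hf
    rw [Nat.cast_zero, contDiffOn_zero]
    exact fun x hx => (hasDerivAt_integral_pow_mul_comp_mul k (fun y hy => hf.hasDerivAt_Ioo hy)
      (contDiffOn_deriv_Ioo hf).continuousOn hx).continuousAt.continuousWithinAt
  | succ n ih =>
    intro f k hf
    exact ContDiffOn.succ_of_hasDerivWithinAt isOpen_Ioo.uniqueDiffOn
      (fun x hx => (hasDerivAt_integral_pow_mul_comp_mul k (fun y hy => hf.hasDerivAt_Ioo hy)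
      (contDiffOn_deriv_Ioo hf).continuousOn hx).hasDerivWithinAt)
      (ih (deriv f) (k + 1) (contDiffOn_deriv_Ioo hf))

/-- **Hadamard's lemma** on a symmetric interval. -/
theorem ContDiffOn.exists_eq_add_mul {a : ℝ} {f : ℝ → ℝ} (hf : ContDiffOn ℝ ∞ f (Ioo (-a) a)) :
    ∃ g : ℝ → ℝ, ContDiffOn ℝ ∞ g (Ioo (-a) a) ∧ ∀ x ∈ Ioo (-a) a, f x = f 0 + x * g x := by
  refine ⟨fun x => ∫ s in (0 : ℝ)..1, s ^ 0 * deriv f (s * x),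
    contDiffOn_infty.2 fun n =>
      contDiffOn_integral_pow_mul_comp_mul n _ 0 (contDiffOn_deriv_Ioo hf), fun x hx => ?_⟩
  have h1 : ∀ s ∈ uIcc (0 : ℝ) 1,
      HasDerivAt (fun s => f (s * x)) (x * (s ^ 0 * deriv f (s * x))) s := by
    intro s hs
    rw [uIcc_of_le zero_le_one] at hs
    have h2 : HasDerivAt (fun s : ℝ => s * x) x s := by
      simpa using (hasDerivAt_id s).mul_const x
    have := (hf.hasDerivAt_Ioo (mul_mem_Ioo_of_mem_Icc hx hs)).comp s h2
    exact this.congr_deriv (by ring)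
  have h3 : ContinuousOn (fun s => x * (s ^ 0 * deriv f (s * x))) (uIcc (0 : ℝ) 1) := by
    rw [uIcc_of_le zero_le_one]
    exact continuousOn_const.mul ((continuous_id.pow 0).continuousOn.mul
      ((contDiffOn_deriv_Ioo hf).continuousOn.comp (by fun_prop)
        fun s hs => mul_mem_Ioo_of_mem_Icc hx hs))
  have h4 := intervalIntegral.integral_eq_sub_of_hasDerivAt h1 h3.intervalIntegrable
  rw [intervalIntegral.integral_const_mul] at h4
  rw [h4]
  simp

/-- A smooth even function is `f 0 + x² g x` with `g` smooth and even. -/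
theorem ContDiffOn.exists_eq_add_sq_mul {a : ℝ} {f : ℝ → ℝ} (hf : ContDiffOn ℝ ∞ f (Ioo (-a) a))
    (heven : ∀ x ∈ Ioo (-a) a, f (-x) = f x) :
    ∃ g : ℝ → ℝ, ContDiffOn ℝ ∞ g (Ioo (-a) a) ∧ (∀ x ∈ Ioo (-a) a, g (-x) = g x) ∧
      ∀ x ∈ Ioo (-a) a, f x = f 0 + x ^ 2 * g x := by
  obtain ⟨h, hh, hfh⟩ := hf.exists_eq_add_mul
  obtain ⟨g, hg, hhg⟩ := hh.exists_eq_add_mul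
  rcases le_or_gt a 0 with ha | ha
  · have hem : ∀ x, x ∉ Ioo (-a) a := fun x hx => by linarith [hx.1, hx.2]
    exact ⟨g, hg, fun x hx => (hem x hx).elim, fun x hx => (hem x hx).elim⟩
  have h0 : (0 : ℝ) ∈ Ioo (-a) a := ⟨by linarith, ha⟩
  have hnhds : Ioo (-a) a ∈ 𝓝 (0 : ℝ) := Ioo_mem_nhds h0.1 h0.2
  have hneg : ∀ x ∈ Ioo (-a) a, -x ∈ Ioo (-a) a := fun x hx =>
    ⟨by linarith [hx.2], by linarith [hx.1]⟩
  -- Evenness of `f` makes `h` odd off `0`, and continuity then forces `h 0 = 0`; this gains the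
  -- second factor `x`.
  have hzero : h 0 = 0 := by
    have hodd : ∀ᶠ x in 𝓝[≠] (0 : ℝ), -h (-x) = h x := by
      filter_upwards [nhdsWithin_le_nhds hnhds, self_mem_nhdsWithin] with x hx hx0
      have e := heven x hx
      rw [hfh x hx, hfh _ (hneg x hx)] at e
      have : x * (h x + h (-x)) = 0 := by linarith
      rcases mul_eq_zero.1 this with h1 | h1
      · exact absurd h1 hx0
      · linarith
    have hc : ContinuousAt h 0 := hh.continuousOn.continuousAt hnhds
    have hc' : Tendsto (fun x => -h (-x)) (𝓝 0) (𝓝 (-h 0)) := by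
      have : ContinuousAt h (-0) := by simpa using hc
      have h2 : Tendsto (fun x => -h (-x)) (𝓝 0) (𝓝 (-h (-0))) :=
        (this.comp (continuous_neg.continuousAt)).neg.tendsto
      rwa [neg_zero (G := ℝ)] at h2
    have := tendsto_nhds_unique ((hc'.mono_left nhdsWithin_le_nhds).congr' hodd)
      (hc.tendsto.mono_left nhdsWithin_le_nhds)
    linarith
  have key : ∀ x ∈ Ioo (-a) a, f x = f 0 + x ^ 2 * g x := by
    intro x hx
    rw [hfh x hx, hhg x hx, hzero]
    ring
  refine ⟨g, hg, fun x hx => ?_, key⟩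
  rcases eq_or_ne x 0 with rfl | hx0
  · simp
  have e := heven x hx
  rw [key x hx, key _ (hneg x hx)] at e
  have h2 : x ^ 2 ≠ 0 := pow_ne_zero 2 hx0
  apply mul_left_cancel₀ h2
  linarith [show (-x) ^ 2 * g (-x) = x ^ 2 * g (-x) by ring]

theorem deriv_neg_of_even_on {a : ℝ} {f : ℝ → ℝ} (hf : ContDiffOn ℝ ∞ f (Ioo (-a) a))
    (heven : ∀ x ∈ Ioo (-a) a, f (-x) = f x) {x : ℝ} (hx : x ∈ Ioo (-a) a) :
    deriv f (-x) = -deriv f x := by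
  have hx' : -x ∈ Ioo (-a) a := ⟨by linarith [hx.2], by linarith [hx.1]⟩
  have h1 := (hf.hasDerivAt_Ioo hx').comp x (hasDerivAt_neg x)
  have h2 : f ∘ Neg.neg =ᶠ[𝓝 x] f := by
    filter_upwards [Ioo_mem_nhds hx.1 hx.2] with y hy using heven y hy
  have := (h1.congr_of_eventuallyEq h2.symm).unique (hf.hasDerivAt_Ioo hx)
  linarith

/-- With `f x = f 0 + x² g x`, the derivative of `f √t = f 0 + t g √t` is `g √t + √t g'(√t) / 2`.
This is again a smooth even function evaluated at `√t`, so the induction closes. -/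
theorem contDiffOn_comp_sqrt_nat {a : ℝ} (ha : 0 < a) (n : ℕ) :
    ∀ f : ℝ → ℝ, ContDiffOn ℝ ∞ f (Ioo (-a) a) → (∀ x ∈ Ioo (-a) a, f (-x) = f x) →
      ContDiffOn ℝ n (fun t => f √t) (Ico 0 (a ^ 2)) := by
  have hsqrt : ∀ t ∈ Ico 0 (a ^ 2), √t ∈ Ioo (-a) a := fun t ht =>
    ⟨by linarith [Real.sqrt_nonneg t], (Real.sqrt_lt' ha).2 ht.2⟩
  induction n with
  | zero =>
    intro f hf _
    rw [Nat.cast_zero, contDiffOn_zero]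
    exact hf.continuousOn.comp Real.continuous_sqrt.continuousOn hsqrt
  | succ n ih =>
    intro f hf heven
    obtain ⟨g, hg, hge, hfg⟩ := hf.exists_eq_add_sq_mul heven
    refine ContDiffOn.succ_of_hasDerivWithinAt (uniqueDiffOn_Ico 0 (a ^ 2))
      (f' := fun t => (fun x => g x + x * deriv g x / 2) √t) (fun t ht => ?_) 
      (ih (fun x => g x + x * deriv g x / 2) ?_ ?_)
    · have h1 : ∀ t ∈ Ico 0 (a ^ 2), f √t = f 0 + t * g √t := fun t ht => by
        rw [hfg _ (hsqrt t ht), Real.sq_sqrt ht.1]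
      suffices HasDerivWithinAt (fun t => f 0 + t * g √t) (g √t + √t * deriv g √t / 2)
        (Ico 0 (a ^ 2)) t from this.congr h1 (h1 t ht)
      rcases eq_or_lt_of_le ht.1 with rfl | ht0
      · rw [Real.sqrt_zero, zero_mul, zero_div, add_zero, hasDerivWithinAt_iff_tendsto_slope]
        have hc : Tendsto (fun t => g √t) (𝓝[Ico 0 (a ^ 2) \ {0}] 0) (𝓝 (g 0)) := by
          have h2 : ContinuousAt g √0 := by
            rw [Real.sqrt_zero]
            exact hg.continuousOn.continuousAt (Ioo_mem_nhds (by linarith) ha)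
          have := (h2.comp Real.continuous_sqrt.continuousAt).tendsto
          simp only [Function.comp_def, Real.sqrt_zero] at this
          exact this.mono_left nhdsWithin_le_nhds
        refine hc.congr' ?_
        filter_upwards [self_mem_nhdsWithin] with t ht'
        have : t ≠ 0 := ht'.2
        simp [slope_def_field]
        field_simp
      · have h2 := (hg.hasDerivAt_Ioo (hsqrt t ht)).comp t (Real.hasDerivAt_sqrt ht0.ne')
        have h3 := ((hasDerivAt_id' t).mul h2).const_add (f 0)
        refine (h3.congr_deriv ?_).hasDerivWithinAt
        have h4 : √t ≠ 0 := (Real.sqrt_pos.2 ht0).ne'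
        have h5 : √t ^ 2 = t := Real.sq_sqrt ht.1
        simp only [Function.comp]
        field_simp
        linear_combination (-(deriv g √t)) * h5
    · exact hg.add ((contDiffOn_id.mul (contDiffOn_deriv_Ioo hg)).div_const 2)
    · intro x hx
      rw [hge x hx, deriv_neg_of_even_on hg hge hx]
      ring

/-- **Whitney's theorem** on even functions: a smooth even function of `x` is a smooth function
of `x²`. -/
theorem contDiffOn_comp_sqrt {a : ℝ} (ha : 0 < a) {f : ℝ → ℝ}
    (hf : ContDiffOn ℝ ∞ f (Ioo (-a) a)) (heven : ∀ x ∈ Ioo (-a) a, f (-x) = f x) :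
    ContDiffOn ℝ ∞ (fun t => f √t) (Ico 0 (a ^ 2)) :=
  contDiffOn_infty.2 fun n => contDiffOn_comp_sqrt_nat ha n f hf heven

/-! ### Smooth extension across an end point -/

/-- Differentiating the extension replaces `(ε, f)` by `(-ε, f')`, and the matching conditions shift
by one order. The sign `ε` must therefore be free in the induction. -/
theorem contDiffOn_reflect_nat {b : ℝ} (hb : 0 < b) (n : ℕ) :
    ∀ (ε : ℝ) (f : ℝ → ℝ), ContDiffOn ℝ ∞ f (Icc 0 b) →
      (∀ k : ℕ, ε * (-1) ^ k * iteratedDerivWithin k f (Icc 0 b) 0 =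
        iteratedDerivWithin k f (Icc 0 b) 0) →
      ContDiffOn ℝ n (fun x => if 0 ≤ x then f x else ε * f (-x)) (Ioo (-b) b) := by
  have hu : UniqueDiffOn ℝ (Icc 0 b) := uniqueDiffOn_Icc hb
  have hderiv : ∀ (ε : ℝ) (f : ℝ → ℝ), ContDiffOn ℝ ∞ f (Icc 0 b) →
      (∀ k : ℕ, ε * (-1) ^ k * iteratedDerivWithin k f (Icc 0 b) 0 =
        iteratedDerivWithin k f (Icc 0 b) 0) → ∀ x ∈ Ioo (-b) b,
      HasDerivAt (fun x => if 0 ≤ x then f x else ε * f (-x))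
        (if 0 ≤ x then derivWithin f (Icc 0 b) x else -ε * derivWithin f (Icc 0 b) (-x)) x := by
    intro ε f hf hk x hx
    have hd : ∀ y ∈ Icc 0 b, HasDerivWithinAt f (derivWithin f (Icc 0 b) y) (Icc 0 b) y :=
      fun y hy => (hf.differentiableOn (by simp) y hy).hasDerivWithinAt
    have hdneg : ∀ y, -y ∈ Icc 0 b → HasDerivWithinAt (fun x => ε * f (-x))
        (-ε * derivWithin f (Icc 0 b) (-y)) (Icc (-b) 0) y := by
      intro y hy
      have := ((hd _ hy).comp y (hasDerivAt_neg y).hasDerivWithinAt (s := Icc (-b) 0)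
        fun z hz => ⟨by linarith [hz.2], by linarith [hz.1]⟩).const_mul ε
      exact this.congr_deriv (by ring)
    rcases lt_trichotomy x 0 with h | rfl | h
    · rw [if_neg h.not_ge]
      refine ((hdneg x ⟨by linarith, by linarith [hx.1]⟩).hasDerivAt
        (Icc_mem_nhds hx.1 h)).congr_of_eventuallyEq ?_
      filter_upwards [Iio_mem_nhds h] with y hy
      rw [if_neg (not_le.2 hy)]
    -- At the junction, order `0` matches the values and order `1` the one-sided derivatives.
    · have hk0 := hk 0
      have hk1 := hk 1
      rw [iteratedDerivWithin_one] at hk1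
      simp only [pow_zero, mul_one, iteratedDerivWithin_zero, pow_one] at hk0 hk1
      rw [if_pos le_rfl]
      have h1 : HasDerivWithinAt (fun x => if 0 ≤ x then f x else ε * f (-x))
          (derivWithin f (Icc 0 b) 0) (Icc 0 b) 0 :=
        (hd 0 ⟨le_rfl, hb.le⟩).congr (fun y hy => if_pos hy.1) (if_pos le_rfl)
      have h2 : HasDerivWithinAt (fun x => if 0 ≤ x then f x else ε * f (-x))
          (derivWithin f (Icc 0 b) 0) (Icc (-b) 0) 0 := by
        have h3 := hdneg 0 (by simpa using hb.le)
        rw [neg_zero] at h3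
        rw [show -ε * derivWithin f (Icc 0 b) 0 = derivWithin f (Icc 0 b) 0 by linarith] at h3
        refine h3.congr (fun y hy => ?_) ?_
        · rcases eq_or_lt_of_le hy.2 with rfl | hy'
          · simp [hk0]
          · rw [if_neg hy'.not_ge]
        · simp [hk0]
      have h3 := h2.union h1
      rw [Icc_union_Icc_eq_Icc (by linarith) hb.le] at h3
      exact h3.hasDerivAt (Icc_mem_nhds hx.1 hx.2)
    · rw [if_pos h.le]
      refine ((hd x ⟨h.le, hx.2.le⟩).hasDerivAt
        (Icc_mem_nhds h hx.2)).congr_of_eventuallyEq ?_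
      filter_upwards [Ioi_mem_nhds h] with y hy
      rw [if_pos (le_of_lt hy)]
  induction n with
  | zero =>
    intro ε f hf hk
    rw [Nat.cast_zero, contDiffOn_zero]
    exact fun x hx => (hderiv ε f hf hk x hx).continuousAt.continuousWithinAt
  | succ n ih =>
    intro ε f hf hk
    refine ContDiffOn.succ_of_hasDerivWithinAt isOpen_Ioo.uniqueDiffOn
      (fun x hx => (hderiv ε f hf hk x hx).hasDerivWithinAt)
      (ih (-ε) (derivWithin f (Icc 0 b)) (hf.derivWithin hu (by simp)) fun k => ?_)
    have := hk (k + 1)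
    rw [iteratedDerivWithin_succ'] at this
    rw [pow_succ] at this
    linarith

/-- If the even derivatives of `f` at `0` vanish then the odd extension of `f` is smooth. -/
theorem contDiffOn_odd_extension {b : ℝ} (hb : 0 < b) {f : ℝ → ℝ} (hf : ContDiffOn ℝ ∞ f (Icc 0 b))
    (hk : ∀ k : ℕ, iteratedDerivWithin (2 * k) f (Icc 0 b) 0 = 0) :
    ContDiffOn ℝ ∞ (fun x => if 0 ≤ x then f x else -f (-x)) (Ioo (-b) b) := by
  have := contDiffOn_infty.2 fun n => contDiffOn_reflect_nat hb n (-1) f hf fun k => by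
    rcases Nat.even_or_odd' k with ⟨j, rfl | rfl⟩
    · simp [hk j]
    · simp [pow_succ, pow_mul]
  simpa using this

/-! ### The jet of `θ` at an end point in terms of `sin² θ` -/

theorem HasDerivAt.derivWithin_Icc_left {b : ℝ} (hb : 0 < b) {f F : ℝ → ℝ} {d : ℝ}
    (hF : HasDerivAt F d 0) (h : F =ᶠ[𝓝[Icc 0 b] 0] f) (h0 : F 0 = f 0) :
    derivWithin f (Icc 0 b) 0 = d :=
  ((hF.hasDerivWithinAt (s := Icc 0 b)).congr_of_eventuallyEq h.symm h0.symm).derivWithin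
    (uniqueDiffOn_Icc hb 0 ⟨le_rfl, hb.le⟩)

theorem angle_mem_Ico {b x : ℝ} (hb : 0 < b) (hx : x ∈ Ico 0 b) :
    Real.pi * x / (2 * b) ∈ Ico 0 (Real.pi / 2) := by
  constructor
  · exact div_nonneg (mul_nonneg Real.pi_pos.le hx.1) (by linarith)
  · rw [div_lt_div_iff₀ (by linarith) two_pos]
    nlinarith [Real.pi_pos, hx.2]

theorem sin_angle_mem_Ico {b x : ℝ} (hb : 0 < b) (hx : x ∈ Ico 0 b) :
    Real.sin (Real.pi * x / (2 * b)) ∈ Ico 0 1 := by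
  obtain ⟨h1, h2⟩ := angle_mem_Ico hb hx
  refine ⟨Real.sin_nonneg_of_nonneg_of_le_pi h1 (by linarith [Real.pi_pos]), ?_⟩
  rw [← Real.sin_pi_div_two]
  exact Real.sin_lt_sin_of_lt_of_le_pi_div_two (by linarith [Real.pi_pos]) le_rfl h2

theorem abs_scaled_arcsin_lt {b σ : ℝ} (hb : 0 < b) (hσ : σ ∈ Ioo (-1 : ℝ) 1) :
    2 * b / Real.pi * Real.arcsin σ ∈ Ioo (-b) b := by
  have h1 := Real.neg_pi_div_two_lt_arcsin.2 hσ.1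
  have h2 := Real.arcsin_lt_pi_div_two.2 hσ.2
  have hc : 0 < 2 * b / Real.pi := by positivity
  have h3 : 2 * b / Real.pi * (Real.pi / 2) = b := by field_simp
  constructor <;> nlinarith

/-- If `θ` is odd to infinite order at `0` with `θ' 0 = 1` then `sin² θ`, as a function of
`t = sin² (π x / 2 b)`, agrees to first order with `(2 b / π)² t`, up to a smooth remainder. -/
theorem exists_sin_sq_expansion {b : ℝ} (hb : 0 < b) {θ : ℝ → ℝ}
    (hθ : ContDiffOn ℝ ∞ θ (Icc 0 b)) (h0 : θ 0 = 0) (h1 : derivWithin θ (Icc 0 b) 0 = 1)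
    (hk : ∀ k : ℕ, 1 ≤ k → iteratedDerivWithin (2 * k) θ (Icc 0 b) 0 = 0) :
    ∃ h : ℝ → ℝ, ContDiffOn ℝ ∞ h (Ico 0 1) ∧ ∀ x ∈ Ico 0 b,
      Real.sin (θ x) ^ 2 = (2 * b / Real.pi) ^ 2 * Real.sin (Real.pi * x / (2 * b)) ^ 2 +
        (Real.sin (Real.pi * x / (2 * b)) ^ 2) ^ 2 *
          h (Real.sin (Real.pi * x / (2 * b)) ^ 2) := by
  have hk' : ∀ k : ℕ, iteratedDerivWithin (2 * k) θ (Icc 0 b) 0 = 0 := fun k => by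
    rcases Nat.eq_zero_or_pos k with rfl | h
    · simp [h0]
    · exact hk k h
  set Θ : ℝ → ℝ := fun x => if 0 ≤ x then θ x else -θ (-x) with hΘ
  have hΘs : ContDiffOn ℝ ∞ Θ (Ioo (-b) b) := contDiffOn_odd_extension hb hθ hk'
  have hΘ0 : Θ 0 = 0 := by simp [hΘ, h0]
  have hΘodd : ∀ x, Θ (-x) = -Θ x := by
    intro x
    rcases lt_trichotomy x 0 with h | rfl | h
    · simp [hΘ, h.not_ge, h.le]
    · simp [hΘ0]
    · simp [hΘ, h.le, h]
  have hΘd : HasDerivAt Θ 1 0 := by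
    have h2 := hΘs.hasDerivAt_Ioo (x := 0) ⟨by linarith, hb⟩
    rwa [← h2.derivWithin_Icc_left hb (f := θ)
      (by filter_upwards [self_mem_nhdsWithin] with x hx using if_pos hx.1) (if_pos le_rfl), h1]
      at h2
  -- The variable `σ` is `sin (πx/2b)`, so that `x = (2b/π) arcsin σ`.
  set f : ℝ → ℝ := fun σ => Real.sin (Θ (2 * b / Real.pi * Real.arcsin σ)) with hf
  have hfs : ContDiffOn ℝ ∞ f (Ioo (-1) 1) := by
    refine Real.contDiff_sin.comp_contDiffOn (hΘs.comp ?_ fun σ hσ => abs_scaled_arcsin_lt hb hσ)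
    exact contDiffOn_const.mul fun σ hσ =>
      (Real.contDiffAt_arcsin hσ.1.ne' hσ.2.ne).contDiffWithinAt
  have hfodd : ∀ σ, f (-σ) = -f σ := fun σ => by
    simp only [hf, Real.arcsin_neg, mul_neg, hΘodd, Real.sin_neg]
  have hf0 : f 0 = 0 := by simp [hf, hΘ0]
  have hfd : HasDerivAt f (2 * b / Real.pi) 0 := by
    have h2 := (Real.hasDerivAt_arcsin (x := 0) (by norm_num) (by norm_num)).const_mul
      (2 * b / Real.pi)
    have h3 : HasDerivAt Θ 1 (2 * b / Real.pi * Real.arcsin 0) := by simpa using hΘd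
    have h4 := (Real.hasDerivAt_sin _).comp 0 (h3.comp 0 h2)
    exact h4.congr_deriv (by simp [hΘ0])
  obtain ⟨g, hg, hge, hfg⟩ := (hfs.pow 2).exists_eq_add_sq_mul fun σ _ => by
    rw [hfodd, neg_sq]
  obtain ⟨u, hu, hue, hgu⟩ := hg.exists_eq_add_sq_mul hge
  -- `g 0` is the limit of `(f σ / σ)²`, hence `f'(0)²`; the hypothesis `θ'(0) = 1` enters here.
  have hg0 : g 0 = (2 * b / Real.pi) ^ 2 := by
    have hn : Ioo (-1 : ℝ) 1 ∈ 𝓝 (0 : ℝ) := Ioo_mem_nhds (by norm_num) one_pos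
    have h2 := (hasDerivAt_iff_tendsto_slope.1 hfd).pow 2
    have h3 : Tendsto g (𝓝[≠] 0) (𝓝 (g 0)) :=
      (hg.continuousOn.continuousAt hn).tendsto.mono_left nhdsWithin_le_nhds
    refine tendsto_nhds_unique h3 (h2.congr' ?_)
    filter_upwards [nhdsWithin_le_nhds hn, self_mem_nhdsWithin] with σ hσ hσ0
    have hσ0' : σ ≠ 0 := hσ0
    have := hfg σ hσ
    rw [slope_def_field, hf0, sub_zero, sub_zero, div_pow, this, hf0]
    field_simp
    ring
  refine ⟨fun t => u √t, by simpa using contDiffOn_comp_sqrt one_pos hu hue, fun x hx => ?_⟩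
  obtain ⟨hs0, hs1⟩ := sin_angle_mem_Ico hb hx
  obtain ⟨ha0, ha1⟩ := angle_mem_Ico hb hx
  set σ := Real.sin (Real.pi * x / (2 * b)) with hσ
  have hσm : σ ∈ Ioo (-1 : ℝ) 1 := ⟨by linarith, hs1⟩
  have hfx : f σ = Real.sin (θ x) := by
    have : 2 * b / Real.pi * Real.arcsin σ = x := by
      rw [hσ, Real.arcsin_sin (by linarith [Real.pi_pos]) ha1.le]
      field_simp
    simp only [hf, this, hΘ, if_pos hx.1]
  beta_reduce
  rw [Real.sqrt_sq hs0, ← hfx, hfg σ hσm, hgu σ hσm, hf0, hg0]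
  ring

/-- Conversely, if `sin² θ = sin² (π x / 2 b) k(x)` with `k` smooth and even and
`k 0 = (2 b / π)²`, then `θ` is odd to infinite order at `0` and `θ' 0 = 1`. -/
theorem odd_jet_of_sin_sq_eq {b : ℝ} (hb : 0 < b) {θ k : ℝ → ℝ}
    (h0 : θ 0 = 0) (hrange : ∀ x ∈ Ioo 0 b, θ x ∈ Ioo 0 (Real.pi / 2)) (hk : ContDiff ℝ ∞ k)
    (heven : ∀ x ∈ Ioo 0 b, k (-x) = k x) (hk0 : k 0 = (2 * b / Real.pi) ^ 2)
    (hsin : ∀ x ∈ Ioo 0 b, Real.sin (θ x) ^ 2 = Real.sin (Real.pi * x / (2 * b)) ^ 2 * k x) :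
    derivWithin θ (Icc 0 b) 0 = 1 ∧
      ∀ j : ℕ, iteratedDerivWithin (2 * j) θ (Icc 0 b) 0 = 0 := by
  set f : ℝ → ℝ := fun x => Real.sin (Real.pi * x / (2 * b)) * √(k x) with hf
  set Θ : ℝ → ℝ := fun x => Real.arcsin (f x) with hΘ
  have hc : 0 < 2 * b / Real.pi := by positivity
  have hf0 : f 0 = 0 := by simp [hf]
  have hkpos : k 0 ≠ 0 := by rw [hk0]; positivity
  have hfs : ContDiffAt ℝ ∞ f 0 := by
    refine ContDiffAt.mul (by fun_prop) (hk.contDiffAt.sqrt hkpos)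
  have hΘs : ContDiffAt ℝ ∞ Θ 0 :=
    ContDiffAt.comp (x := (0 : ℝ)) (g := Real.arcsin) (f := f)
      (by rw [hf0]; exact Real.contDiffAt_arcsin (by norm_num) (by norm_num)) hfs
  have hΘ0 : Θ 0 = 0 := by simp [hΘ, hf0]
  have heq : Θ =ᶠ[𝓝[Icc 0 b] 0] θ := by
    filter_upwards [self_mem_nhdsWithin, nhdsWithin_le_nhds (Iio_mem_nhds hb)] with x hx hxb
    rcases eq_or_lt_of_le hx.1 with rfl | hx0
    · rw [hΘ0, h0]
    · have hxm : x ∈ Ioo 0 b := ⟨hx0, hxb⟩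
      obtain ⟨h2, h3⟩ := hrange x hxm
      have h4 : Real.sin (θ x) = f x := by
        have hs : 0 ≤ Real.sin (θ x) :=
          Real.sin_nonneg_of_nonneg_of_le_pi h2.le (by linarith [Real.pi_pos])
        have hs' := (sin_angle_mem_Ico hb ⟨hx0.le, hxb⟩).1
        rw [← Real.sqrt_sq hs, hsin x hxm, Real.sqrt_mul (sq_nonneg _), Real.sqrt_sq hs']
      simp only [hΘ]
      rw [← h4, Real.arcsin_sin (by linarith) h3.le]
  have hodd : (fun x => Θ (-x)) =ᶠ[𝓝 0] fun x => -Θ x := by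
    have hfodd : ∀ x ∈ Ioo 0 b, f (-x) = -f x := fun x hx => by
      simp only [hf, heven x hx, mul_neg, neg_div, Real.sin_neg, neg_mul]
    filter_upwards [Ioo_mem_nhds (neg_lt_zero.2 hb) hb] with x hx
    rcases lt_trichotomy x 0 with h | rfl | h
    · have := hfodd (-x) ⟨by linarith, by linarith [hx.1]⟩
      rw [neg_neg] at this
      simp only [hΘ, this, Real.arcsin_neg, neg_neg]
    · simp [hΘ0]
    · simp only [hΘ, hfodd x ⟨h, hx.2⟩, Real.arcsin_neg]
  have hu : UniqueDiffOn ℝ (Icc 0 b) := uniqueDiffOn_Icc hb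
  have hmem : (0 : ℝ) ∈ Icc 0 b := ⟨le_rfl, hb.le⟩
  constructor
  · refine HasDerivAt.derivWithin_Icc_left hb (F := Θ) ?_ heq (by rw [hΘ0, h0])
    have h2 : HasDerivAt (fun x => Real.pi * x / (2 * b)) (Real.pi / (2 * b)) 0 := by
      simpa using ((hasDerivAt_id (0 : ℝ)).const_mul Real.pi).div_const (2 * b)
    have h3 := h2.sin
    have h4 : HasDerivAt k (deriv k 0) 0 := (hk.differentiable (by simp) 0).hasDerivAt
    have h5 := h3.mul (h4.sqrt hkpos)
    have h6 : HasDerivAt f 1 0 := by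
      refine h5.congr_deriv ?_
      simp only [mul_zero, zero_div, Real.cos_zero, Real.sin_zero, zero_mul, add_zero, one_mul,
        hk0, Real.sqrt_sq hc.le]
      have := Real.pi_ne_zero
      field_simp
    have h7 : HasDerivAt Real.arcsin 1 (f 0) := by
      rw [hf0]
      exact (Real.hasDerivAt_arcsin (by norm_num) (by norm_num)).congr_deriv (by simp)
    exact (h7.comp 0 h6).congr_deriv (by simp)
  · intro j
    -- One-sided derivatives of `θ` are those of the smooth function `Θ`, whose germ at `0` is odd;
    -- an even-order derivative there equals its own negative.
    rw [← heq.iteratedDerivWithin_eq (by rw [hΘ0, h0]),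
      iteratedDerivWithin_eq_iteratedDeriv hu (contDiffAt_infty.1 hΘs _) hmem]
    have h2 := hodd.iteratedDeriv_eq (2 * j)
    rw [iteratedDeriv_comp_neg, iteratedDeriv_fun_neg] at h2
    simp at h2
    linarith

/-! ### Profiles smooth on the whole interval, from the jets at both ends -/

theorem ContDiffOn.exists_glue_Icc {p q : ℝ → ℝ} (hp : ContDiffOn ℝ ∞ p (Ico 0 1))
    (hq : ContDiffOn ℝ ∞ q (Ioc 0 1)) (hpq : ∀ t ∈ Ioo (0 : ℝ) 1, p t = q t) :
    ∃ f : ℝ → ℝ, ContDiffOn ℝ ∞ f (Icc 0 1) ∧ EqOn f p (Ico 0 1) ∧ EqOn f q (Ioc 0 1) := by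
  have h1 : EqOn (fun t => if t < 1 then p t else q t) p (Ico 0 1) := fun t ht => if_pos ht.2
  have h2 : EqOn (fun t => if t < 1 then p t else q t) q (Ioc 0 1) := fun t ht => by
    rcases lt_or_ge t 1 with h | h
    · simp only [if_pos h, hpq t ⟨ht.1, h⟩]
    · simp only [if_neg h.not_gt]
  refine ⟨_, fun t ht => ?_, h1, h2⟩
  rcases lt_or_ge t 1 with h | h
  · refine (hp.congr h1 t ⟨ht.1, h⟩).mono_of_mem_nhdsWithin ?_
    filter_upwards [self_mem_nhdsWithin, nhdsWithin_le_nhds (Iio_mem_nhds h)] with s hs hs'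
      using ⟨hs.1, hs'⟩
  · have h0 : 0 < t := by linarith
    refine (hq.congr h2 t ⟨h0, ht.2⟩).mono_of_mem_nhdsWithin ?_
    filter_upwards [self_mem_nhdsWithin, nhdsWithin_le_nhds (Ioi_mem_nhds h0)] with s hs hs'
      using ⟨hs', hs.2⟩

theorem sin_sq_angle_sub {b : ℝ} (hb : 0 < b) (x : ℝ) :
    Real.sin (Real.pi * (b - x) / (2 * b)) ^ 2 = 1 - Real.sin (Real.pi * x / (2 * b)) ^ 2 := by
  have : Real.pi * (b - x) / (2 * b) = Real.pi / 2 - Real.pi * x / (2 * b) := by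
    field_simp
  rw [this, Real.sin_pi_div_two_sub, Real.cos_sq']

open Pointwise in
theorem iteratedDerivWithin_reflect {b : ℝ} (θ : ℝ → ℝ) {n : ℕ} (hn : 0 < n)
    {x : ℝ} :
    iteratedDerivWithin n (fun x => Real.pi / 2 - θ (b - x)) (Icc 0 b) x =
      -((-1) ^ n * iteratedDerivWithin n θ (Icc 0 b) (b - x)) := by
  have hset : b +ᵥ -(Icc 0 b) = Icc 0 b := by
    ext y
    rw [mem_vadd_set_iff_neg_vadd_mem]
    simp only [vadd_eq_add, Set.mem_neg, mem_Icc]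
    constructor <;> rintro ⟨h1, h2⟩ <;> constructor <;> linarith
  rw [iteratedDerivWithin_const_sub hn, iteratedDerivWithin_fun_neg,
    iteratedDerivWithin_comp_const_sub, hset]
  simp only [smul_eq_mul]

theorem derivWithin_reflect {b : ℝ} (θ : ℝ → ℝ) {x : ℝ} :
    derivWithin (fun x => Real.pi / 2 - θ (b - x)) (Icc 0 b) x =
      derivWithin θ (Icc 0 b) (b - x) := by
  rw [← iteratedDerivWithin_one, iteratedDerivWithin_reflect θ one_pos, iteratedDerivWithin_one]
  ring

theorem contDiffOn_reflect {b : ℝ} {θ : ℝ → ℝ} (hθ : ContDiffOn ℝ ∞ θ (Icc 0 b)) :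
    ContDiffOn ℝ ∞ (fun x => Real.pi / 2 - θ (b - x)) (Icc 0 b) :=
  contDiffOn_const.sub (hθ.comp (by fun_prop) fun x hx => ⟨by linarith [hx.2], by linarith [hx.1]⟩)

/-- The boundary conditions at an end point where the angle `θ` starts from `0`. -/
structure IsOddUnitJet (b : ℝ) (θ : ℝ → ℝ) : Prop where
  smooth : ContDiffOn ℝ ∞ θ (Icc 0 b)
  zero : θ 0 = 0
  deriv_one : derivWithin θ (Icc 0 b) 0 = 1
  even_zero : ∀ k : ℕ, 1 ≤ k → iteratedDerivWithin (2 * k) θ (Icc 0 b) 0 = 0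

/-- The expansion at each end gives a remainder smooth up to that end. In the interior both are
determined by `sin² θ`, so they agree and can be glued. -/
theorem exists_profile_of_isOddUnitJet {b : ℝ} (hb : 0 < b) {θ φ : ℝ → ℝ}
    (hθ : IsOddUnitJet b θ) (hφ : IsOddUnitJet b φ)
    (hθφ : ∀ x ∈ Icc 0 b, φ (b - x) = Real.pi / 2 - θ x) :
    ∃ α : ℝ → ℝ, ContDiffOn ℝ ∞ α (Icc 0 1) ∧ ∀ x ∈ Icc 0 b,
      Real.sin (θ x) ^ 2 = (2 * b / Real.pi) ^ 2 * Real.sin (Real.pi * x / (2 * b)) ^ 2 +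
        (Real.sin (Real.pi * x / (2 * b)) ^ 2) ^ 2 *
          α (Real.sin (Real.pi * x / (2 * b)) ^ 2) := by
  obtain ⟨p, hp, hpe⟩ := exists_sin_sq_expansion hb hθ.smooth hθ.zero hθ.deriv_one hθ.even_zero
  obtain ⟨r, hr, hre⟩ := exists_sin_sq_expansion hb hφ.smooth hφ.zero hφ.deriv_one hφ.even_zero
  set c := (2 * b / Real.pi) ^ 2
  -- Solves `1 - sin² θ = c (1 - t) + (1 - t)² r(1 - t)` for the remainder; dividing by `t²` is
  -- harmless away from `t = 0`.
  set q : ℝ → ℝ := fun t => (1 - (c * (1 - t) + (1 - t) ^ 2 * r (1 - t)) - c * t) / t ^ 2 with hq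
  have hqs : ContDiffOn ℝ ∞ q (Ioc 0 1) := by
    refine ContDiffOn.div ?_ (by fun_prop) fun t ht => pow_ne_zero 2 ht.1.ne'
    have : ContDiffOn ℝ ∞ (fun t => r (1 - t)) (Ioc 0 1) :=
      hr.comp (by fun_prop) fun t ht => ⟨by linarith [ht.2], by linarith [ht.1]⟩
    exact (contDiffOn_const.sub ((contDiffOn_const.mul (contDiffOn_const.sub contDiffOn_id)).add
      (((contDiffOn_const.sub contDiffOn_id).pow 2).mul this))).sub
        (contDiffOn_const.mul contDiffOn_id)
  have hqe : ∀ x ∈ Ioc 0 b, Real.sin (θ x) ^ 2 = c * Real.sin (Real.pi * x / (2 * b)) ^ 2 +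
        (Real.sin (Real.pi * x / (2 * b)) ^ 2) ^ 2 *
          q (Real.sin (Real.pi * x / (2 * b)) ^ 2) := by
    intro x hx
    have h1 := hre (b - x) ⟨by linarith [hx.2], by linarith [hx.1]⟩
    rw [hθφ x ⟨hx.1.le, hx.2⟩, Real.sin_pi_div_two_sub, sin_sq_angle_sub hb, Real.cos_sq'] at h1
    have hs : Real.sin (Real.pi * x / (2 * b)) ≠ 0 := by
      refine (Real.sin_pos_of_pos_of_lt_pi ?_ ?_).ne'
      · have := hx.1
        positivity
      · rw [div_lt_iff₀ (by linarith)]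
        nlinarith [Real.pi_pos, hx.2]
    simp only [hq]
    field_simp
    linear_combination -h1
  obtain ⟨α, hα, hαp, hαq⟩ := hp.exists_glue_Icc hqs fun t ht => by
    have hsq0 : 0 < √t := Real.sqrt_pos.2 ht.1
    have hsq1 : √t < 1 := (Real.sqrt_lt' one_pos).2 (by simpa using ht.2)
    have hx1 := (abs_scaled_arcsin_lt hb (σ := √t) ⟨by linarith, hsq1⟩).2
    have hx0 : 0 < 2 * b / Real.pi * Real.arcsin √t :=
      mul_pos (by positivity) (Real.arcsin_pos.2 hsq0)
    have hT : Real.sin (Real.pi * (2 * b / Real.pi * Real.arcsin √t) / (2 * b)) ^ 2 = t := by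
      have : Real.pi * (2 * b / Real.pi * Real.arcsin √t) / (2 * b) = Real.arcsin √t := by
        field_simp
      rw [this, Real.sin_arcsin (by linarith) hsq1.le, Real.sq_sqrt ht.1.le]
    have h1 := hpe _ ⟨hx0.le, hx1⟩
    rw [hqe _ ⟨hx0, hx1.le⟩, hT] at h1
    exact (mul_left_cancel₀ (pow_ne_zero 2 ht.1.ne') (add_left_cancel h1)).symm
  refine ⟨α, hα, fun x hx => ?_⟩
  rcases eq_or_lt_of_le hx.2 with rfl | hxb
  · rw [hqe x ⟨hb, le_rfl⟩, hαq]
    have : Real.pi * x / (2 * x) = Real.pi / 2 := by field_simp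
    rw [this, Real.sin_pi_div_two]
    simp
  · rw [hpe x ⟨hx.1, hxb⟩, hαp]
    obtain ⟨h1, h2⟩ := sin_angle_mem_Ico hb ⟨hx.1, hxb⟩
    exact ⟨sq_nonneg _, pow_lt_one₀ h1 h2 two_ne_zero⟩

/-! ### Metrics on `S³` restricted from bilinear forms on `ℝ⁴` -/

/-- Euclidean space of dimension four, in which `S³` lives. -/
abbrev E4 : Type := EuclideanSpace ℝ (Fin 4)

/-- The model space of `S³`. -/
abbrev E3 : Type := EuclideanSpace ℝ (Fin 3)

theorem fact_finrank_E4 : Fact (Module.finrank ℝ E4 = 3 + 1) :=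
  ⟨finrank_euclideanSpace_fin⟩

theorem contMDiff_coe_S3 : ContMDiff (𝓡 3) 𝓘(ℝ, E4) ∞ ((↑) : S3 → E4) :=
  haveI := fact_finrank_E4
  contMDiff_coe_sphere (n := 3)

theorem ContDiff.contMDiff_S3 {E : Type*} [NormedAddCommGroup E] [NormedSpace ℝ E] {f : E → S3}
    (hf : ContDiff ℝ ∞ fun x => (f x : E4)) : ContMDiff 𝓘(ℝ, E) (𝓡 3) ∞ f :=
  haveI := fact_finrank_E4
  hf.contMDiff.codRestrict_sphere (n := 3) fun x => (f x).2

/-- The derivative of the inclusion of `S³` in `ℝ⁴`. -/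
noncomputable def dCoe (p : S3) : TangentSpace (𝓡 3) p →L[ℝ] E4 :=
  mfderiv (𝓡 3) 𝓘(ℝ, E4) ((↑) : S3 → E4) p

theorem dCoe_injective (p : S3) : Function.Injective (dCoe p) :=
  haveI := fact_finrank_E4
  injective_mvfderiv_subtypeVal_sphere (n := 3) p

theorem dCoe_mfderiv {E : Type*} [NormedAddCommGroup E] [NormedSpace ℝ E] {f : E → S3}
    (hf : ContDiff ℝ ∞ fun x => (f x : E4)) (x v : E) :
    dCoe (f x) (mfderiv 𝓘(ℝ, E) (𝓡 3) f x v) = fderiv ℝ (fun x => (f x : E4)) x v := by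
  have h1 := (contMDiff_coe_S3.mdifferentiable (by simp)) (f x)
  have h2 := (hf.contMDiff_S3.mdifferentiable (by simp)) x
  have h3 := mfderiv_comp x h1 h2
  rw [mfderiv_eq_fderiv] at h3
  exact (congrArg (fun L : E →L[ℝ] E4 => L v) h3).symm

/-- A bilinear form on `ℝ⁴` restricted to the tangent space of the sphere. -/
noncomputable def sphereForm (B : S3 → E4 →L[ℝ] E4 →L[ℝ] ℝ) (p : S3) :
    TangentSpace (𝓡 3) p →L[ℝ] TangentSpace (𝓡 3) p →L[ℝ] ℝ :=
  show E3 →L[ℝ] E3 →L[ℝ] ℝ from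
    (B p).bilinearComp (dCoe p : E3 →L[ℝ] E4) (dCoe p : E3 →L[ℝ] E4)

theorem sphereForm_apply (B : S3 → E4 →L[ℝ] E4 →L[ℝ] ℝ) (p : S3) (v w : TangentSpace (𝓡 3) p) :
    sphereForm B p v w = B p (dCoe p v) (dCoe p w) := rfl

set_option synthInstance.maxHeartbeats 200000 in
theorem ContMDiffAt.clm_flip {X Y : Type*} [NormedAddCommGroup X] [NormedSpace ℝ X]
    [NormedAddCommGroup Y] [NormedSpace ℝ Y] {f : S3 → X →L[ℝ] Y →L[ℝ] ℝ} {p₀ : S3}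
    (hf : ContMDiffAt (𝓡 3) 𝓘(ℝ, X →L[ℝ] Y →L[ℝ] ℝ) ∞ f p₀) :
    ContMDiffAt (𝓡 3) 𝓘(ℝ, Y →L[ℝ] X →L[ℝ] ℝ) ∞ (fun p => (f p).flip) p₀ :=
  have h : ContDiff ℝ ∞ fun g : X →L[ℝ] Y →L[ℝ] ℝ => g.flip :=
    show ContDiff ℝ ∞ ⇑(ContinuousLinearMap.flipₗᵢ ℝ X Y ℝ) from LinearIsometryEquiv.contDiff _
  h.contMDiff.contMDiffAt.comp p₀ hf

theorem contMDiff_sphereForm {B : S3 → E4 →L[ℝ] E4 →L[ℝ] ℝ}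
    (hB : ContMDiff (𝓡 3) 𝓘(ℝ, E4 →L[ℝ] E4 →L[ℝ] ℝ) ∞ B) :
    ContMDiff (𝓡 3) ((𝓡 3).prod 𝓘(ℝ, E3 →L[ℝ] E3 →L[ℝ] ℝ)) ∞
      (fun p => TotalSpace.mk' (E3 →L[ℝ] E3 →L[ℝ] ℝ)
        (E := fun p : S3 => TangentSpace (𝓡 3) p →L[ℝ] TangentSpace (𝓡 3) p →L[ℝ] ℝ)
        p (sphereForm B p)) := by
  intro p₀
  rw [contMDiffAt_hom_bundle]
  refine ⟨contMDiffAt_id, ?_⟩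
  have hD := (contMDiff_coe_S3 p₀).mfderiv_const (m := ∞) (by simp)
  set D := inTangentCoordinates (𝓡 3) 𝓘(ℝ, E4) id
    ((↑) : S3 → E4) (mfderiv (𝓡 3) 𝓘(ℝ, E4) ((↑) : S3 → E4)) p₀
  have hsm : ContMDiffAt (𝓡 3) 𝓘(ℝ, E3 →L[ℝ] E3 →L[ℝ] ℝ) ∞
      -- In tangent coordinates the form is `B (D ·) (D ·)`. Composition reaches only the first
      -- argument, so a flip exposes the second.
      (fun p => (((B p).comp (D p)).flip.comp (D p)).flip) p₀ :=
    (((hB p₀).clm_comp hD).clm_flip.clm_comp hD).clm_flip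
  refine hsm.congr_of_eventuallyEq ?_
  have hbase : (trivializationAt E3 (TangentSpace (𝓡 3)) p₀).baseSet ∈ 𝓝 p₀ :=
    (Trivialization.open_baseSet _).mem_nhds (FiberBundle.mem_baseSet_trivializationAt' p₀)
  filter_upwards [hbase] with p hp
  ext v w
  have h := inCoordinates_apply_eq₂ (F₁ := E3) (E₁ := fun p : S3 => TangentSpace (𝓡 3) p)
    (F₂ := E3) (E₂ := fun p : S3 => TangentSpace (𝓡 3) p)
    (F₃ := ℝ) (E₃ := Bundle.Trivial S3 ℝ) (ϕ := sphereForm B p) (v := v) (w := w) hp hp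
      (mem_univ _)
  refine h.trans ?_
  have hDv : ∀ u, D p u = dCoe p ((trivializationAt E3 (TangentSpace (𝓡 3)) p₀).symm p u) := by
    intro u
    have h1 := TangentBundle.continuousLinearMapAt_model_space (𝕜 := ℝ) (p₀ : E4) (p : E4)
    simp only [D, inTangentCoordinates, ContinuousLinearMap.inCoordinates,
      ContinuousLinearMap.comp_apply]
    refine (congrArg (fun L : E4 →L[ℝ] E4 => L (dCoe p
      ((trivializationAt E3 (TangentSpace (𝓡 3)) p₀).symmL ℝ p u))) h1).trans ?_
    exact congrArg (dCoe p) (Trivialization.symmL_apply _ hp u)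
  simp only [ContinuousLinearMap.flip_apply, ContinuousLinearMap.comp_apply, hDv]
  simp [sphereForm_apply]

/-- By compactness the form is at least some `m > 0` on the unit sphere, so `L v v < 1` bounds
`‖v‖²` by `1 / m`. -/
theorem isVonNBounded_of_pos {E : Type*} [NormedAddCommGroup E] [NormedSpace ℝ E]
    [FiniteDimensional ℝ E] (L : E →L[ℝ] E →L[ℝ] ℝ) (hL : ∀ v, v ≠ 0 → 0 < L v v) :
    Bornology.IsVonNBounded ℝ {v : E | L v v < 1} := by
  have hcont : Continuous fun v => L v v := by fun_prop
  obtain ⟨m, hm, hmL⟩ : ∃ m : ℝ, 0 < m ∧ ∀ v ∈ Metric.sphere (0 : E) 1, m ≤ L v v := by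
    rcases (Metric.sphere (0 : E) 1).eq_empty_or_nonempty with he | hne
    · exact ⟨1, one_pos, by simp [he]⟩
    · obtain ⟨u, hu, hmin⟩ := (isCompact_sphere (0 : E) 1).exists_isMinOn hne hcont.continuousOn
      exact ⟨L u u, hL u (ne_zero_of_mem_unit_sphere ⟨u, hu⟩), fun v hv => hmin hv⟩
  refine (NormedSpace.isVonNBounded_ball ℝ E (√(1 / m) + 1)).subset fun v hv => ?_
  rw [mem_ball_zero_iff]
  refine lt_of_le_of_lt (Real.le_sqrt_of_sq_le ?_) (lt_add_one _)
  rcases eq_or_ne v 0 with rfl | hv0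
  · simp [hm.le]
  have hn : ‖v‖ ≠ 0 := norm_ne_zero_iff.2 hv0
  have h1 := hmL (‖v‖⁻¹ • v) (by simp [norm_smul, hn])
  simp only [map_smul, smul_apply, smul_eq_mul] at h1
  have h2 : L v v < 1 := hv
  rw [le_div_iff₀ hm]
  have h3 : ‖v‖ ^ 2 * (‖v‖⁻¹ * (‖v‖⁻¹ * L v v)) = L v v := by field_simp
  nlinarith [mul_le_mul_of_nonneg_left h1 (sq_nonneg ‖v‖)]

/-- A smooth family of inner products on `ℝ⁴` parametrised by `S³` restricts to a smooth metric. -/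
theorem exists_smoothMetricS3 {B : S3 → E4 →L[ℝ] E4 →L[ℝ] ℝ}
    (hB : ContMDiff (𝓡 3) 𝓘(ℝ, E4 →L[ℝ] E4 →L[ℝ] ℝ) ∞ B)
    (hsymm : ∀ p v w, B p v w = B p w v) (hpos : ∀ p v, v ≠ 0 → 0 < B p v v) :
    ∃ G : SmoothMetricS3, ∀ (p : S3) (v w : TangentSpace (𝓡 3) p),
      G.inner p v w = B p (dCoe p v) (dCoe p w) := by
  have hpos' : ∀ (p : S3) (v : TangentSpace (𝓡 3) p), v ≠ 0 → 0 < sphereForm B p v v :=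
    fun p v hv => hpos p _ fun h => hv (dCoe_injective p (h.trans (map_zero _).symm))
  exact ⟨{ inner := sphereForm B
           symm := fun p v w => hsymm p _ _
           pos := hpos'
           isVonNBounded := fun p =>
             isVonNBounded_of_pos (E := E3) (sphereForm B p) (hpos' p)
           contMDiff := contMDiff_sphereForm hB }, fun p v w => rfl⟩

/-! ### Evaluating a smooth metric along curves -/

theorem contDiff_inner_mfderiv (G : SmoothMetricS3) {E : Type*} [NormedAddCommGroup E]
    [NormedSpace ℝ E] {f : E → S3} (hf : ContDiff ℝ ∞ fun x => (f x : E4)) {A : ℝ → E}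
    (hA : ContDiff ℝ ∞ A) (v : E) :
    ContDiff ℝ ∞ fun x => G.inner (f (A x)) (mfderiv 𝓘(ℝ, E) (𝓡 3) f (A x) v)
      (mfderiv 𝓘(ℝ, E) (𝓡 3) f (A x) v) := by
  have hvec : ContMDiff 𝓘(ℝ, ℝ) 𝓘(ℝ, E).tangent ∞
      (fun x => (⟨A x, v⟩ : TangentBundle 𝓘(ℝ, E) E)) :=
    (contMDiff_vectorSpace_iff_contDiff (V := fun _ : E => v) |>.2 contDiff_const).comp
      hA.contMDiff
  have hsec : ContMDiff 𝓘(ℝ, ℝ) ((𝓡 3).prod 𝓘(ℝ, E3)) ∞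
      (fun x => TotalSpace.mk' E3 (E := fun p : S3 => TangentSpace (𝓡 3) p) (f (A x))
        (mfderiv 𝓘(ℝ, E) (𝓡 3) f (A x) v)) :=
    (hf.contMDiff_S3.contMDiff_tangentMap (m := ∞) (by simp)).comp hvec
  have hbase : ContMDiff 𝓘(ℝ, ℝ) (𝓡 3) ∞ fun x => f (A x) := hf.contMDiff_S3.comp hA.contMDiff
  have h : ContMDiff 𝓘(ℝ, ℝ) ((𝓡 3).prod 𝓘(ℝ, ℝ)) ∞
      (fun x => TotalSpace.mk' ℝ (E := Bundle.Trivial S3 ℝ) (f (A x))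
        (G.inner (f (A x)) (mfderiv 𝓘(ℝ, E) (𝓡 3) f (A x) v)
          (mfderiv 𝓘(ℝ, E) (𝓡 3) f (A x) v))) :=
    ContMDiff.clm_bundle_apply₂ (F₁ := E3) (F₂ := E3) (G.contMDiff.comp hbase) hsec hsec
  rw [← contMDiff_iff_contDiff]
  intro x
  have := h x
  simp only [contMDiffAt_totalSpace] at this
  exact this.2

/-- Tangent vectors arising from different parametrisations are compared through their images in
`ℝ⁴`, where the inclusion has injective derivative. -/
theorem inner_self_eq_of_dCoe (G : SmoothMetricS3) {p p' : S3} (hp : p = p')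
    {ξ : TangentSpace (𝓡 3) p} {ξ' : TangentSpace (𝓡 3) p'} {c : ℝ}
    (h : dCoe p ξ = c • dCoe p' ξ') : G.inner p ξ ξ = c ^ 2 * G.inner p' ξ' ξ' := by
  subst hp
  have : ξ = c • ξ' := dCoe_injective p (h.trans (map_smul _ _ _).symm)
  subst this
  simp
  ring

theorem fderiv_apply_of_hasDerivAt_coord {E : Type*} [NormedAddCommGroup E] [NormedSpace ℝ E]
    {f : E → E4} {q v : E} {w : E4} (hf : ContDiff ℝ ∞ f)
    (h : ∀ i, HasDerivAt (fun t : ℝ => f (q + t • v) i) (w i) 0) : fderiv ℝ f q v = w := by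
  have h1 : HasFDerivAt f (fderiv ℝ f q) (q + (0 : ℝ) • v) := by
    simpa using (hf.differentiable (by simp) q).hasFDerivAt
  have h2 : HasDerivAt (fun t : ℝ => q + t • v) v 0 := by
    simpa using ((hasDerivAt_id (0 : ℝ)).smul_const v).const_add q
  have h3 := h1.comp_hasDerivAt (0 : ℝ) h2
  ext i
  have h4 := (EuclideanSpace.proj i : E4 →L[ℝ] ℝ).hasFDerivAt
    (x := f (q + (0 : ℝ) • v)) |>.comp_hasDerivAt (0 : ℝ) h3
  exact h4.unique (h i)

theorem contDiff_joinVec (b : ℝ) : ContDiff ℝ ∞ (joinVec b) := by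
  rw [contDiff_euclidean]
  intro i
  fin_cases i <;> simp [joinVec] <;> fun_prop

theorem fderiv_joinVec (b : ℝ) (q v : ℝ × ℝ × ℝ) :
    fderiv ℝ (joinVec b) q v =
      !₂[Real.pi / (2 * b) * v.1 * Real.cos (Real.pi * q.1 / (2 * b)) * Real.cos q.2.1 -
          Real.sin (Real.pi * q.1 / (2 * b)) * (Real.sin q.2.1 * v.2.1),
        Real.pi / (2 * b) * v.1 * Real.cos (Real.pi * q.1 / (2 * b)) * Real.sin q.2.1 +
          Real.sin (Real.pi * q.1 / (2 * b)) * (Real.cos q.2.1 * v.2.1),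
        -(Real.pi / (2 * b) * v.1 * Real.sin (Real.pi * q.1 / (2 * b))) * Real.cos q.2.2 -
          Real.cos (Real.pi * q.1 / (2 * b)) * (Real.sin q.2.2 * v.2.2),
        -(Real.pi / (2 * b) * v.1 * Real.sin (Real.pi * q.1 / (2 * b))) * Real.sin q.2.2 +
          Real.cos (Real.pi * q.1 / (2 * b)) * (Real.cos q.2.2 * v.2.2)] := by
  refine fderiv_apply_of_hasDerivAt_coord (contDiff_joinVec b) fun i => ?_
  have hlin : ∀ a c : ℝ, HasDerivAt (fun t : ℝ => a + t * c) c 0 := fun a c => by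
    simpa using ((hasDerivAt_id (0 : ℝ)).mul_const c).const_add a
  have hs : HasDerivAt (fun t : ℝ => Real.pi * (q.1 + t * v.1) / (2 * b))
      (Real.pi / (2 * b) * v.1) 0 :=
    (((hlin q.1 v.1).const_mul Real.pi).div_const (2 * b)).congr_deriv (by ring)
  have hy := hlin q.2.1 v.2.1
  have hz := hlin q.2.2 v.2.2
  fin_cases i
  · refine (hs.sin.mul hy.cos).congr_deriv ?_
    simp
    ring
  · refine (hs.sin.mul hy.sin).congr_deriv ?_
    simp
    exact Or.inl (by ring)
  · refine (hs.cos.mul hz.cos).congr_deriv ?_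
    simp
    ring
  · refine (hs.cos.mul hz.sin).congr_deriv ?_
    simp
    exact Or.inl (by ring)

theorem contDiff_coe_joinCoord (b : ℝ) : ContDiff ℝ ∞ fun q => (joinCoord b q : E4) :=
  contDiff_joinVec b

theorem dCoe_mfderiv_joinCoord (b : ℝ) (q v : ℝ × ℝ × ℝ) :
    dCoe (joinCoord b q) (mfderiv 𝓘(ℝ, ℝ × ℝ × ℝ) (𝓡 3) (joinCoord b) q v) =
      fderiv ℝ (joinVec b) q v :=
  dCoe_mfderiv (contDiff_coe_joinCoord b) q v

/-- Evaluating a smooth metric on a smooth vector field `e` that spans the collapsing direction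
along a curve `x ↦ F (x, 0)` through the collapsed circle; `P`, `M` are the coordinates of the two
halves of the curve and `N` those of a curve leaving the circle in the direction of `e`. -/
theorem exists_even_factor {b : ℝ} (hb : 0 < b) {θ ψ : ℝ → ℝ} {G : SmoothMetricS3}
    (hG : ∀ q : ℝ × ℝ × ℝ, q.1 ∈ Ioo 0 b → ∀ v w : ℝ × ℝ × ℝ,
      G.inner (joinCoord b q)
        (mfderiv 𝓘(ℝ, ℝ × ℝ × ℝ) (𝓡 3) (joinCoord b) q v)
        (mfderiv 𝓘(ℝ, ℝ × ℝ × ℝ) (𝓡 3) (joinCoord b) q w) = coordMetric θ q v w)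
    {F : ℝ × ℝ → S3} (hF : ContDiff ℝ ∞ fun p => (F p : E4)) {e : E4}
    (hFe : ∀ x, fderiv ℝ (fun p => (F p : E4)) (x, 0) (0, 1) = e)
    {P M N : ℝ → ℝ × ℝ × ℝ} {u u' d : ℝ × ℝ × ℝ} (hN : ContDiff ℝ ∞ N)
    (hPF : ∀ x, joinVec b (P x) = F (x, 0)) (hMF : ∀ x, joinVec b (M x) = F (-x, 0))
    (hNF : joinVec b (N 0) = F (0, 0))
    (hPm : ∀ x ∈ Ioo 0 b, (P x).1 ∈ Ioo 0 b) (hMm : ∀ x ∈ Ioo 0 b, (M x).1 ∈ Ioo 0 b)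
    (hNm : ∀ x ∈ Ioo 0 b, (N x).1 ∈ Ioo 0 b)
    (hPe : ∀ x, fderiv ℝ (joinVec b) (P x) u = Real.sin (Real.pi * x / (2 * b)) • e)
    (hMe : ∀ x, fderiv ℝ (joinVec b) (M x) u' = Real.sin (Real.pi * x / (2 * b)) • e)
    (hNe : fderiv ℝ (joinVec b) (N 0) d = (Real.pi / (2 * b)) • e)
    (hPg : ∀ x, coordMetric θ (P x) u u = Real.sin (ψ x) ^ 2)
    (hMg : ∀ x, coordMetric θ (M x) u' u' = Real.sin (ψ x) ^ 2)
    (hNg : ∀ x, coordMetric θ (N x) d d = 1) :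
    ∃ k : ℝ → ℝ, ContDiff ℝ ∞ k ∧ (∀ x ∈ Ioo 0 b, k (-x) = k x) ∧
      k 0 = (2 * b / Real.pi) ^ 2 ∧
      ∀ x ∈ Ioo 0 b, Real.sin (ψ x) ^ 2 = Real.sin (Real.pi * x / (2 * b)) ^ 2 * k x := by
  set k : ℝ → ℝ := fun x => G.inner (F (x, 0)) (mfderiv 𝓘(ℝ, ℝ × ℝ) (𝓡 3) F (x, 0) (0, 1))
    (mfderiv 𝓘(ℝ, ℝ × ℝ) (𝓡 3) F (x, 0) (0, 1)) with hkdef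
  have hk : ContDiff ℝ ∞ k :=
    contDiff_inner_mfderiv G hF (A := fun x => (x, 0)) (by fun_prop) (0, 1)
  have hcmp : ∀ (q v : ℝ × ℝ × ℝ) (x c : ℝ), joinVec b q = F (x, 0) →
      fderiv ℝ (joinVec b) q v = c • e →
      G.inner (joinCoord b q) (mfderiv 𝓘(ℝ, ℝ × ℝ × ℝ) (𝓡 3) (joinCoord b) q v)
        (mfderiv 𝓘(ℝ, ℝ × ℝ × ℝ) (𝓡 3) (joinCoord b) q v) = c ^ 2 * k x := by
    intro q v x c hq hv
    refine inner_self_eq_of_dCoe G (Subtype.ext hq) ?_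
    rw [dCoe_mfderiv_joinCoord, hv]
    exact congrArg (c • ·) ((dCoe_mfderiv hF _ _).trans (hFe x)).symm
  have hP : ∀ x ∈ Ioo 0 b,
      Real.sin (ψ x) ^ 2 = Real.sin (Real.pi * x / (2 * b)) ^ 2 * k x := fun x hx => by
    rw [← hPg, ← hG _ (hPm x hx)]
    exact hcmp _ _ _ _ (hPF x) (hPe x)
  have hM : ∀ x ∈ Ioo 0 b,
      Real.sin (ψ x) ^ 2 = Real.sin (Real.pi * x / (2 * b)) ^ 2 * k (-x) := fun x hx => by
    rw [← hMg, ← hG _ (hMm x hx)]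
    exact hcmp _ _ _ _ (hMF x) (hMe x)
  refine ⟨k, hk, fun x hx => ?_, ?_, hP⟩
  · have hs : Real.sin (Real.pi * x / (2 * b)) ≠ 0 := by
      obtain ⟨h1, h2⟩ := angle_mem_Ico hb ⟨hx.1.le, hx.2⟩
      refine (Real.sin_pos_of_pos_of_lt_pi ?_ (by linarith [Real.pi_pos])).ne'
      have := hx.1
      positivity
    exact mul_left_cancel₀ (pow_ne_zero 2 hs) ((hM x hx).symm.trans (hP x hx))
  -- The formula for the metric holds only off the collapsed circle, so the value on it is obtained
  -- as a limit from `x > 0`.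
  · have hcont := (contDiff_inner_mfderiv G (contDiff_coe_joinCoord b) hN d).continuous
    have h0 := hcmp (N 0) d 0 _ hNF hNe
    have hlim := (hcont.tendsto 0).mono_left (nhdsWithin_le_nhds (s := Ioi 0))
    have h1 : Tendsto (fun _ : ℝ => (1 : ℝ)) (𝓝[>] 0) (𝓝 ((Real.pi / (2 * b)) ^ 2 * k 0)) := by
      rw [← h0]
      refine hlim.congr' ?_
      filter_upwards [self_mem_nhdsWithin, nhdsWithin_le_nhds (Iio_mem_nhds hb)] with x hx hx'
      rw [hG _ (hNm x ⟨hx, hx'⟩), hNg]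
    have h2 := tendsto_nhds_unique h1 tendsto_const_nhds
    have := Real.pi_ne_zero
    field_simp at h2 ⊢
    linarith

/-! ### Necessity of the end point conditions -/

/-- Leaving `(0, π/2)` in the interior would, by the intermediate value theorem, produce a second
zero or a second point with value `π/2`. This range lets `θ` be recovered from `sin² θ`. -/
theorem angle_range {b : ℝ} {θ : ℝ → ℝ} (hθ : ContinuousOn θ (Icc 0 b))
    (hzero : {x ∈ Icc 0 b | θ x = 0} = {0})
    (hpi : {x ∈ Icc 0 b | θ x = Real.pi / 2} = {b}) :
    θ 0 = 0 ∧ θ b = Real.pi / 2 ∧ ∀ x ∈ Ioo 0 b, θ x ∈ Ioo 0 (Real.pi / 2) := by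
  have h0 : θ 0 = 0 := (hzero.symm ▸ mem_singleton (0 : ℝ) : (0 : ℝ) ∈ {x ∈ Icc 0 b | θ x = 0}).2
  have h1 : θ b = Real.pi / 2 :=
    (hpi.symm ▸ mem_singleton b : b ∈ {x ∈ Icc 0 b | θ x = Real.pi / 2}).2
  refine ⟨h0, h1, fun x hx => ?_⟩
  constructor
  · by_contra! h
    obtain ⟨y, hy, hy0⟩ := intermediate_value_Icc hx.2.le
      (hθ.mono (Icc_subset_Icc_left hx.1.le)) ⟨h, by rw [h1]; positivity⟩
    have : y ∈ ({0} : Set ℝ) := hzero ▸ ⟨⟨hx.1.le.trans hy.1, hy.2⟩, hy0⟩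
    rw [mem_singleton_iff] at this
    linarith [hy.1, hx.1]
  · by_contra! h
    obtain ⟨y, hy, hy0⟩ := intermediate_value_Icc hx.1.le
      (hθ.mono (Icc_subset_Icc_right hx.2.le)) ⟨by rw [h0]; positivity, h⟩
    have : y ∈ ({b} : Set ℝ) := hpi ▸ ⟨⟨hy.1, hy.2.trans hx.2.le⟩, hy0⟩
    rw [mem_singleton_iff] at this
    linarith [hy.2, hx.2]

theorem angle_reflect {b : ℝ} (hb : 0 < b) (x : ℝ) :
    Real.pi * (b - x) / (2 * b) = Real.pi / 2 - Real.pi * x / (2 * b) := by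
  field_simp

theorem angle_neg (b x : ℝ) : Real.pi * -x / (2 * b) = -(Real.pi * x / (2 * b)) := by
  ring

theorem hasDerivAt_add_smul_coord (a c : ℝ) : HasDerivAt (fun t : ℝ => a + t * c) c 0 := by
  simpa using ((hasDerivAt_id (0 : ℝ)).mul_const c).const_add a

/-- The curve through the circle `x = 0`, rotated towards the second coordinate direction. -/
theorem exists_frame_at_zero (b : ℝ) : ∃ F : ℝ × ℝ → S3,
    ContDiff ℝ ∞ (fun p => (F p : E4)) ∧
    (∀ x, (F (x, 0) : E4) =
      !₂[Real.sin (Real.pi * x / (2 * b)), 0, Real.cos (Real.pi * x / (2 * b)), 0]) ∧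
    ∀ x, fderiv ℝ (fun p => (F p : E4)) (x, 0) (0, 1) = !₂[0, 1, 0, 0] := by
  set f : ℝ × ℝ → E4 := fun p => !₂[Real.cos p.2 * Real.sin (Real.pi * p.1 / (2 * b)), Real.sin p.2,
    Real.cos p.2 * Real.cos (Real.pi * p.1 / (2 * b)), 0] with hf
  have hmem : ∀ p, f p ∈ Metric.sphere (0 : E4) 1 := by
    intro p
    rw [mem_sphere_zero_iff_norm, EuclideanSpace.norm_eq, Real.sqrt_eq_one]
    simp only [hf, Fin.sum_univ_four, Real.norm_eq_abs, sq_abs]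
    simp
    linear_combination Real.sin_sq_add_cos_sq p.2 +
      Real.cos p.2 ^ 2 * Real.sin_sq_add_cos_sq (Real.pi * p.1 / (2 * b))
  have hs : ContDiff ℝ ∞ f := by
    rw [contDiff_euclidean]
    intro i
    fin_cases i <;> simp [hf] <;> fun_prop
  refine ⟨fun p => ⟨f p, hmem p⟩, hs, fun x => by simp [hf], fun x => ?_⟩
  refine fderiv_apply_of_hasDerivAt_coord hs fun i => ?_
  have h0 := hasDerivAt_add_smul_coord 0 1
  have hA : HasDerivAt (fun t : ℝ => Real.pi * (x + t * 0) / (2 * b)) 0 0 := by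
    simpa using hasDerivAt_const (0 : ℝ) (Real.pi * x / (2 * b))
  fin_cases i
  · exact (h0.cos.mul hA.sin).congr_deriv (by simp)
  · exact h0.sin.congr_deriv (by simp)
  · exact (h0.cos.mul hA.cos).congr_deriv (by simp)
  · exact hasDerivAt_const (0 : ℝ) (0 : ℝ)

/-- The curve through the circle `x = b`, rotated towards the fourth coordinate direction. -/
theorem exists_frame_at_end (b : ℝ) : ∃ F : ℝ × ℝ → S3,
    ContDiff ℝ ∞ (fun p => (F p : E4)) ∧
    (∀ x, (F (x, 0) : E4) =
      !₂[Real.cos (Real.pi * x / (2 * b)), 0, Real.sin (Real.pi * x / (2 * b)), 0]) ∧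
    ∀ x, fderiv ℝ (fun p => (F p : E4)) (x, 0) (0, 1) = !₂[0, 0, 0, 1] := by
  set f : ℝ × ℝ → E4 := fun p => !₂[Real.cos p.2 * Real.cos (Real.pi * p.1 / (2 * b)), 0,
    Real.cos p.2 * Real.sin (Real.pi * p.1 / (2 * b)), Real.sin p.2] with hf
  have hmem : ∀ p, f p ∈ Metric.sphere (0 : E4) 1 := by
    intro p
    rw [mem_sphere_zero_iff_norm, EuclideanSpace.norm_eq, Real.sqrt_eq_one]
    simp only [hf, Fin.sum_univ_four, Real.norm_eq_abs, sq_abs]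
    simp
    linear_combination Real.sin_sq_add_cos_sq p.2 +
      Real.cos p.2 ^ 2 * Real.sin_sq_add_cos_sq (Real.pi * p.1 / (2 * b))
  have hs : ContDiff ℝ ∞ f := by
    rw [contDiff_euclidean]
    intro i
    fin_cases i <;> simp [hf] <;> fun_prop
  refine ⟨fun p => ⟨f p, hmem p⟩, hs, fun x => by simp [hf], fun x => ?_⟩
  refine fderiv_apply_of_hasDerivAt_coord hs fun i => ?_
  have h0 := hasDerivAt_add_smul_coord 0 1
  have hA : HasDerivAt (fun t : ℝ => Real.pi * (x + t * 0) / (2 * b)) 0 0 := by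
    simpa using hasDerivAt_const (0 : ℝ) (Real.pi * x / (2 * b))
  fin_cases i
  · exact (h0.cos.mul hA.cos).congr_deriv (by simp)
  · exact hasDerivAt_const (0 : ℝ) (0 : ℝ)
  · exact (h0.cos.mul hA.sin).congr_deriv (by simp)
  · exact h0.sin.congr_deriv (by simp)

theorem jets_of_definesSmoothMetricS3 {b : ℝ} (hb : 0 < b) {θ : ℝ → ℝ}
    (h0 : θ 0 = 0) (h1 : θ b = Real.pi / 2)
    (hrange : ∀ x ∈ Ioo 0 b, θ x ∈ Ioo 0 (Real.pi / 2)) (h : DefinesSmoothMetricS3 b θ) :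
    derivWithin θ (Icc 0 b) 0 = 1 ∧ derivWithin θ (Icc 0 b) b = 1 ∧
      ∀ k : ℕ, 1 ≤ k → iteratedDerivWithin (2 * k) θ (Icc 0 b) 0 = 0 ∧
        iteratedDerivWithin (2 * k) θ (Icc 0 b) b = 0 := by
  obtain ⟨G, hG⟩ := h
  have hrefl : ∀ x ∈ Ioo 0 b, b - x ∈ Ioo 0 b := fun x hx =>
    ⟨by linarith [hx.2], by linarith [hx.1]⟩
  obtain ⟨k, hk, hke, hk0, hks⟩ : ∃ k : ℝ → ℝ, ContDiff ℝ ∞ k ∧ (∀ x ∈ Ioo 0 b, k (-x) = k x) ∧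
      k 0 = (2 * b / Real.pi) ^ 2 ∧
      ∀ x ∈ Ioo 0 b, Real.sin (θ x) ^ 2 = Real.sin (Real.pi * x / (2 * b)) ^ 2 * k x := by
    obtain ⟨F, hF, hF0, hFe⟩ := exists_frame_at_zero b
    -- Crossing the circle turns `y = 0` into `y = π`, where `-∂_y` is the positive multiple of `e`;
    -- at `y = π/2` the vector `∂_x` itself points along `e`.
    refine exists_even_factor hb hG hF hFe (P := fun x => (x, 0, 0)) (M := fun x => (x, Real.pi, 0))
      (N := fun x => (x, Real.pi / 2, 0)) (u := (0, 1, 0)) (u' := (0, -1, 0)) (d := (1, 0, 0))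
      (by fun_prop) ?_ ?_ ?_ (fun x hx => hx) (fun x hx => hx) (fun x hx => hx) ?_ ?_ ?_ ?_ ?_ ?_
    · intro x
      rw [hF0]
      simp [joinVec]
    · intro x
      rw [hF0, angle_neg]
      simp [joinVec]
    · rw [hF0]
      simp [joinVec]
    · intro x
      rw [fderiv_joinVec]
      ext i
      fin_cases i <;> simp
    · intro x
      rw [fderiv_joinVec]
      ext i
      fin_cases i <;> simp
    · rw [fderiv_joinVec]
      ext i
      fin_cases i <;> simp
    all_goals
      intro x
      simp [coordMetric]
  obtain ⟨l, hl, hle, hl0, hls⟩ : ∃ k : ℝ → ℝ, ContDiff ℝ ∞ k ∧ (∀ x ∈ Ioo 0 b, k (-x) = k x) ∧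
      k 0 = (2 * b / Real.pi) ^ 2 ∧
      ∀ x ∈ Ioo 0 b, Real.sin ((fun x => Real.pi / 2 - θ (b - x)) x) ^ 2 =
        Real.sin (Real.pi * x / (2 * b)) ^ 2 * k x := by
    obtain ⟨F, hF, hF0, hFe⟩ := exists_frame_at_end b
    have hbb : Real.pi * b / (2 * b) = Real.pi / 2 := by field_simp
    -- The distance to the circle is now `b - x`, so the outward direction is `-∂_x` and `z` plays
    -- the role of `y`.
    refine exists_even_factor hb hG hF hFe (P := fun x => (b - x, 0, 0))
      (M := fun x => (b - x, 0, Real.pi)) (N := fun x => (b - x, 0, Real.pi / 2))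
      (u := (0, 0, 1)) (u' := (0, 0, -1)) (d := (-1, 0, 0))
      (by fun_prop) ?_ ?_ ?_ hrefl hrefl hrefl ?_ ?_ ?_ ?_ ?_ ?_
    · intro x
      rw [hF0]
      simp [joinVec, angle_reflect hb, Real.sin_pi_div_two_sub, Real.cos_pi_div_two_sub]
    · intro x
      rw [hF0, angle_neg]
      simp [joinVec, angle_reflect hb, Real.sin_pi_div_two_sub, Real.cos_pi_div_two_sub]
    · rw [hF0]
      simp [joinVec, hbb]
    · intro x
      rw [fderiv_joinVec]
      ext i
      fin_cases i <;> simp [angle_reflect hb, Real.cos_pi_div_two_sub]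
    · intro x
      rw [fderiv_joinVec]
      ext i
      fin_cases i <;> simp [angle_reflect hb, Real.cos_pi_div_two_sub]
    · rw [fderiv_joinVec]
      ext i
      fin_cases i <;> simp [hbb]
    all_goals
      intro x
      simp [coordMetric, Real.sin_pi_div_two_sub]
  obtain ⟨hd, hj⟩ := odd_jet_of_sin_sq_eq hb h0 hrange hk hke hk0 hks
  obtain ⟨hd', hj'⟩ := odd_jet_of_sin_sq_eq hb (by simp [h1])
    (fun x hx => by
      obtain ⟨h2, h3⟩ := hrange _ (hrefl x hx)
      exact ⟨by linarith, by linarith⟩) hl hle hl0 hls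
  rw [derivWithin_reflect, sub_zero] at hd'
  refine ⟨hd, hd', fun j hj1 => ⟨hj j, ?_⟩⟩
  have := hj' j
  rw [iteratedDerivWithin_reflect θ (by omega), sub_zero] at this
  simpa using this

/-! ### Sufficiency of the end point conditions -/

/-- Split `x` into its parts along and across `a`: after multiplication by `|a|⁴` the form is `c
|a|² (a · x)² + A (a × x)²`. At `a = 0` only `c |x|²` remains. -/
theorem planar_form_pos {c α A a₀ a₁ x₀ x₁ : ℝ} (hc : 0 < c)
    (hA : A = c * (a₀ ^ 2 + a₁ ^ 2) + (a₀ ^ 2 + a₁ ^ 2) ^ 2 * α)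
    (hpos : 0 < a₀ ^ 2 + a₁ ^ 2 → 0 < A) (hx : 0 < x₀ ^ 2 + x₁ ^ 2) :
    0 < c * (x₀ ^ 2 + x₁ ^ 2) + α * (a₀ * x₁ - a₁ * x₀) ^ 2 := by
  rcases eq_or_lt_of_le (show 0 ≤ a₀ ^ 2 + a₁ ^ 2 by positivity) with h | h
  · have h0 : a₀ = 0 := by nlinarith [sq_nonneg a₀, sq_nonneg a₁]
    have h1 : a₁ = 0 := by nlinarith [sq_nonneg a₀, sq_nonneg a₁]
    subst h0 h1
    simpa using mul_pos hc hx
  · have hA0 := hpos h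
    have key : (a₀ ^ 2 + a₁ ^ 2) ^ 2 *
        (c * (x₀ ^ 2 + x₁ ^ 2) + α * (a₀ * x₁ - a₁ * x₀) ^ 2) =
        c * (a₀ ^ 2 + a₁ ^ 2) * (a₀ * x₀ + a₁ * x₁) ^ 2 + A * (a₀ * x₁ - a₁ * x₀) ^ 2 := by
      rw [hA]
      ring
    have hsum : (a₀ * x₀ + a₁ * x₁) ^ 2 + (a₀ * x₁ - a₁ * x₀) ^ 2 =
        (a₀ ^ 2 + a₁ ^ 2) * (x₀ ^ 2 + x₁ ^ 2) := by ring
    have hsum' := mul_pos h hx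
    rw [← hsum] at hsum'
    refine pos_of_mul_pos_right (a := (a₀ ^ 2 + a₁ ^ 2) ^ 2) ?_ (sq_nonneg _)
    rw [key]
    rcases eq_or_lt_of_le (sq_nonneg (a₀ * x₁ - a₁ * x₀)) with h2 | h2
    · rw [← h2] at hsum' ⊢
      have := mul_pos (mul_pos hc h) (by linarith : 0 < (a₀ * x₀ + a₁ * x₁) ^ 2)
      linarith
    · have := mul_pos hA0 h2
      have : 0 ≤ c * (a₀ ^ 2 + a₁ ^ 2) * (a₀ * x₀ + a₁ * x₁) ^ 2 := by positivity
      linarith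

/-- The one-form dual to the rotation of the `(i, j)` coordinate plane. -/
noncomputable def rotationForm (i j : Fin 4) (p : E4) : E4 →L[ℝ] ℝ :=
  p i • (EuclideanSpace.proj j : E4 →L[ℝ] ℝ) - p j • (EuclideanSpace.proj i : E4 →L[ℝ] ℝ)

theorem rotationForm_apply (i j : Fin 4) (p x : E4) :
    rotationForm i j p x = p i * x j - p j * x i := rfl

theorem contDiff_rotationForm (i j : Fin 4) : ContDiff ℝ ∞ (rotationForm i j) := by
  have h : ∀ k : Fin 4, ContDiff ℝ ∞ fun p : E4 => p k := fun k =>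
    (EuclideanSpace.proj k : E4 →L[ℝ] ℝ).contDiff
  exact ((h i).smul contDiff_const).sub ((h j).smul contDiff_const)

/-- The inner product of `ℝ⁴` as a bilinear form. -/
noncomputable def dotForm : E4 →L[ℝ] E4 →L[ℝ] ℝ := innerSL ℝ

theorem dotForm_apply (x y : E4) :
    dotForm x y = x 0 * y 0 + x 1 * y 1 + x 2 * y 2 + x 3 * y 3 := by
  change inner ℝ x y = _
  simp [PiLp.inner_apply, Fin.sum_univ_four, mul_comm]

/-- The bilinear form `c ⟨·,·⟩ + α ω₀₁ ⊗ ω₀₁ + β ω₂₃ ⊗ ω₂₃` on `ℝ⁴`, where `α` and `β` depend on the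
squared distances to the two coordinate planes. -/
noncomputable def toralForm (c : ℝ) (α β : ℝ → ℝ) (p : S3) : E4 →L[ℝ] E4 →L[ℝ] ℝ :=
  c • dotForm
    + α ((p : E4) 0 ^ 2 + (p : E4) 1 ^ 2) • (rotationForm 0 1 p).smulRight (rotationForm 0 1 p)
    + β ((p : E4) 2 ^ 2 + (p : E4) 3 ^ 2) • (rotationForm 2 3 p).smulRight (rotationForm 2 3 p)

theorem toralForm_apply (c : ℝ) (α β : ℝ → ℝ) (p : S3) (x y : E4) :
    toralForm c α β p x y = c * (x 0 * y 0 + x 1 * y 1 + x 2 * y 2 + x 3 * y 3)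
      + α ((p : E4) 0 ^ 2 + (p : E4) 1 ^ 2) *
        (((p : E4) 0 * x 1 - (p : E4) 1 * x 0) * ((p : E4) 0 * y 1 - (p : E4) 1 * y 0))
      + β ((p : E4) 2 ^ 2 + (p : E4) 3 ^ 2) *
        (((p : E4) 2 * x 3 - (p : E4) 3 * x 2) * ((p : E4) 2 * y 3 - (p : E4) 3 * y 2)) := by
  simp [toralForm, rotationForm_apply, dotForm_apply]

theorem sum_sq_coe_S3 (p : S3) :
    (p : E4) 0 ^ 2 + (p : E4) 1 ^ 2 + ((p : E4) 2 ^ 2 + (p : E4) 3 ^ 2) = 1 := by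
  have h := p.2
  rw [mem_sphere_zero_iff_norm, EuclideanSpace.norm_eq, Real.sqrt_eq_one] at h
  simp only [Fin.sum_univ_four, Real.norm_eq_abs, sq_abs] at h
  linarith

theorem contMDiff_comp_coe {V : Type*} [NormedAddCommGroup V] [NormedSpace ℝ V] {f : E4 → V}
    (hf : ContDiff ℝ ∞ f) : ContMDiff (𝓡 3) 𝓘(ℝ, V) ∞ fun p : S3 => f p :=
  hf.contMDiff.comp contMDiff_coe_S3

theorem contMDiff_toralForm (c : ℝ) {α β : ℝ → ℝ} (hα : ContDiffOn ℝ ∞ α (Icc 0 1))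
    (hβ : ContDiffOn ℝ ∞ β (Icc 0 1)) :
    ContMDiff (𝓡 3) 𝓘(ℝ, E4 →L[ℝ] E4 →L[ℝ] ℝ) ∞ (toralForm c α β) := by
  have hcoord : ∀ k : Fin 4, ContDiff ℝ ∞ fun p : E4 => p k := fun k =>
    (EuclideanSpace.proj k : E4 →L[ℝ] ℝ).contDiff
  have hscal : ∀ (γ : ℝ → ℝ) (i j : Fin 4), ContDiffOn ℝ ∞ γ (Icc 0 1) →
      (∀ p : S3, (p : E4) i ^ 2 + (p : E4) j ^ 2 ∈ Icc (0 : ℝ) 1) →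
      ContMDiff (𝓡 3) 𝓘(ℝ, ℝ) ∞ fun p : S3 => γ ((p : E4) i ^ 2 + (p : E4) j ^ 2) :=
    fun γ i j hγ hm => hγ.contMDiffOn.comp_contMDiff
      (contMDiff_comp_coe (((hcoord i).pow 2).add ((hcoord j).pow 2))) hm
  have htens : ∀ i j : Fin 4, ContMDiff (𝓡 3) 𝓘(ℝ, E4 →L[ℝ] E4 →L[ℝ] ℝ) ∞
      fun p : S3 => (rotationForm i j p).smulRight (rotationForm i j p) := fun i j =>
    contMDiff_comp_coe ((contDiff_rotationForm i j).smulRight (contDiff_rotationForm i j))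
  refine ((contMDiff_const (c := c • dotForm)).add ((hscal α 0 1 hα fun p => ?_).smul (htens 0 1))).add
    ((hscal β 2 3 hβ fun p => ?_).smul (htens 2 3))
  · have := sum_sq_coe_S3 p
    constructor <;> nlinarith [sq_nonneg ((p : E4) 2), sq_nonneg ((p : E4) 3),
      sq_nonneg ((p : E4) 0), sq_nonneg ((p : E4) 1)]
  · have := sum_sq_coe_S3 p
    constructor <;> nlinarith [sq_nonneg ((p : E4) 2), sq_nonneg ((p : E4) 3),
      sq_nonneg ((p : E4) 0), sq_nonneg ((p : E4) 1)]

/-- The form is block diagonal for `ℝ² × ℝ²`, and each block is positive by `planar_form_pos`, with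
`A` and `1 - A` in the roles of `sin² θ` and `cos² θ`. -/
theorem toralForm_pos {c : ℝ} (hc : 0 < c) {α β : ℝ → ℝ}
    (h : ∀ t ∈ Icc (0 : ℝ) 1, ∃ A : ℝ, A = c * t + t ^ 2 * α t ∧
      1 - A = c * (1 - t) + (1 - t) ^ 2 * β (1 - t) ∧ (0 < t → 0 < A) ∧ (t < 1 → A < 1))
    (p : S3) {x : E4} (hx : x ≠ 0) : 0 < toralForm c α β p x x := by
  have hsum := sum_sq_coe_S3 p
  obtain ⟨A, hA, hA', hA0, hA1⟩ := h ((p : E4) 0 ^ 2 + (p : E4) 1 ^ 2)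
    ⟨by positivity, by linarith [sq_nonneg ((p : E4) 2), sq_nonneg ((p : E4) 3)]⟩
  have hsub : 1 - ((p : E4) 0 ^ 2 + (p : E4) 1 ^ 2) = (p : E4) 2 ^ 2 + (p : E4) 3 ^ 2 := by
    linarith
  rw [hsub] at hA'
  have h1 := planar_form_pos (x₀ := x 0) (x₁ := x 1) hc hA hA0
  have h2 := planar_form_pos (x₀ := x 2) (x₁ := x 3) hc hA' (fun h => by linarith [hA1 (by linarith)])
  have hform : toralForm c α β p x x =
      (c * (x 0 ^ 2 + x 1 ^ 2) +
        α ((p : E4) 0 ^ 2 + (p : E4) 1 ^ 2) * ((p : E4) 0 * x 1 - (p : E4) 1 * x 0) ^ 2) +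
      (c * (x 2 ^ 2 + x 3 ^ 2) +
        β ((p : E4) 2 ^ 2 + (p : E4) 3 ^ 2) * ((p : E4) 2 * x 3 - (p : E4) 3 * x 2) ^ 2) := by
    rw [toralForm_apply]
    ring
  have hzero : ∀ a b : ℝ, a ^ 2 + b ^ 2 = 0 → a = 0 ∧ b = 0 := fun a b hab =>
    ⟨by nlinarith [sq_nonneg a, sq_nonneg b], by nlinarith [sq_nonneg a, sq_nonneg b]⟩
  rw [hform]
  rcases eq_or_lt_of_le (show 0 ≤ x 0 ^ 2 + x 1 ^ 2 by positivity) with h01 | h01 <;>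
  rcases eq_or_lt_of_le (show 0 ≤ x 2 ^ 2 + x 3 ^ 2 by positivity) with h23 | h23
  · obtain ⟨e0, e1⟩ := hzero _ _ h01.symm
    obtain ⟨e2, e3⟩ := hzero _ _ h23.symm
    refine absurd ?_ hx
    ext i
    fin_cases i <;> assumption
  · obtain ⟨e0, e1⟩ := hzero _ _ h01.symm
    simpa [e0, e1] using h2 h23
  · obtain ⟨e2, e3⟩ := hzero _ _ h23.symm
    simpa [e2, e3] using h1 h01
  · exact add_pos (h1 h01) (h2 h23)

theorem toralForm_joinCoord {b : ℝ} (hb : 0 < b) {θ α β : ℝ → ℝ} {q : ℝ × ℝ × ℝ}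
    (hα : Real.sin (θ q.1) ^ 2 = (2 * b / Real.pi) ^ 2 * Real.sin (Real.pi * q.1 / (2 * b)) ^ 2 +
      (Real.sin (Real.pi * q.1 / (2 * b)) ^ 2) ^ 2 *
        α (Real.sin (Real.pi * q.1 / (2 * b)) ^ 2))
    (hβ : Real.cos (θ q.1) ^ 2 = (2 * b / Real.pi) ^ 2 * Real.cos (Real.pi * q.1 / (2 * b)) ^ 2 +
      (Real.cos (Real.pi * q.1 / (2 * b)) ^ 2) ^ 2 *
        β (Real.cos (Real.pi * q.1 / (2 * b)) ^ 2)) (v w : ℝ × ℝ × ℝ) :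
    toralForm ((2 * b / Real.pi) ^ 2) α β (joinCoord b q) (fderiv ℝ (joinVec b) q v)
      (fderiv ℝ (joinVec b) q w) = coordMetric θ q v w := by
  rw [coordMetric, hα, hβ, toralForm_apply, fderiv_joinVec, fderiv_joinVec]
  set s := Real.pi * q.1 / (2 * b)
  have e0 : (joinCoord b q : E4) 0 = Real.sin s * Real.cos q.2.1 := rfl
  have e1 : (joinCoord b q : E4) 1 = Real.sin s * Real.sin q.2.1 := rfl
  have e2 : (joinCoord b q : E4) 2 = Real.cos s * Real.cos q.2.2 := rfl
  have e3 : (joinCoord b q : E4) 3 = Real.cos s * Real.sin q.2.2 := rfl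
  have hs := Real.sin_sq_add_cos_sq s
  have hy := Real.sin_sq_add_cos_sq q.2.1
  have hz := Real.sin_sq_add_cos_sq q.2.2
  have e01 : (joinCoord b q : E4) 0 ^ 2 + (joinCoord b q : E4) 1 ^ 2 = Real.sin s ^ 2 := by
    rw [e0, e1]
    linear_combination Real.sin s ^ 2 * hy
  have e23 : (joinCoord b q : E4) 2 ^ 2 + (joinCoord b q : E4) 3 ^ 2 = Real.cos s ^ 2 := by
    rw [e2, e3]
    linear_combination Real.cos s ^ 2 * hz
  rw [e01, e23, e0, e1, e2, e3]
  set r := Real.pi / (2 * b) with hr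
  -- The choice of `c` normalises the coefficient of `dx²` to `1`.
  have hcr : (2 * b / Real.pi) ^ 2 * r ^ 2 = 1 := by
    rw [hr]
    have := Real.pi_ne_zero
    field_simp
  set c := (2 * b / Real.pi) ^ 2
  set S := Real.sin s
  set C := Real.cos s
  set Sy := Real.sin q.2.1
  set Cy := Real.cos q.2.1
  set Sz := Real.sin q.2.2
  set Cz := Real.cos q.2.2
  have w1 : ∀ v : ℝ × ℝ × ℝ, S * Cy * (r * v.1 * C * Sy + S * (Cy * v.2.1)) -
      S * Sy * (r * v.1 * C * Cy - S * (Sy * v.2.1)) = S ^ 2 * v.2.1 := fun v => by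
    linear_combination (S ^ 2 * v.2.1) * hy
  have w2 : ∀ v : ℝ × ℝ × ℝ, C * Cz * (-(r * v.1 * S) * Sz + C * (Cz * v.2.2)) -
      C * Sz * (-(r * v.1 * S) * Cz - C * (Sz * v.2.2)) = C ^ 2 * v.2.2 := fun v => by
    linear_combination (C ^ 2 * v.2.2) * hz
  simp only [Matrix.cons_val]
  rw [w1, w1, w2, w2]
  linear_combination (v.1 * w.1 * (C ^ 2 + S ^ 2)) * hcr + v.1 * w.1 * hs +
    c * (r ^ 2 * v.1 * w.1 * C ^ 2 + S ^ 2 * v.2.1 * w.2.1) * hy +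
    c * (r ^ 2 * v.1 * w.1 * S ^ 2 + C ^ 2 * v.2.2 * w.2.2) * hz

theorem definesSmoothMetricS3_of_jets {b : ℝ} (hb : 0 < b) {θ : ℝ → ℝ}
    (hθ : ContDiffOn ℝ ∞ θ (Icc 0 b)) (h0 : θ 0 = 0) (h1 : θ b = Real.pi / 2)
    (hrange : ∀ x ∈ Ioo 0 b, θ x ∈ Ioo 0 (Real.pi / 2))
    (hd0 : derivWithin θ (Icc 0 b) 0 = 1) (hd1 : derivWithin θ (Icc 0 b) b = 1)
    (hk : ∀ k : ℕ, 1 ≤ k → iteratedDerivWithin (2 * k) θ (Icc 0 b) 0 = 0 ∧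
      iteratedDerivWithin (2 * k) θ (Icc 0 b) b = 0) : DefinesSmoothMetricS3 b θ := by
  have hjθ : IsOddUnitJet b θ := ⟨hθ, h0, hd0, fun k hk1 => (hk k hk1).1⟩
  have hjφ : IsOddUnitJet b (fun x => Real.pi / 2 - θ (b - x)) := by
    refine ⟨contDiffOn_reflect hθ, by simp [h1], ?_, fun k hk1 => ?_⟩
    · rw [derivWithin_reflect, sub_zero, hd1]
    · rw [iteratedDerivWithin_reflect θ (by omega), sub_zero, (hk k hk1).2]
      simp
  obtain ⟨α, hα, hαe⟩ := exists_profile_of_isOddUnitJet hb hjθ hjφ fun x _ => by simp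
  obtain ⟨β, hβ, hβe⟩ := exists_profile_of_isOddUnitJet hb hjφ hjθ fun x _ => by simp
  have hβe' : ∀ x ∈ Icc 0 b, Real.cos (θ x) ^ 2 =
      (2 * b / Real.pi) ^ 2 * Real.cos (Real.pi * x / (2 * b)) ^ 2 +
        (Real.cos (Real.pi * x / (2 * b)) ^ 2) ^ 2 *
          β (Real.cos (Real.pi * x / (2 * b)) ^ 2) := by
    intro x hx
    have := hβe (b - x) ⟨by linarith [hx.2], by linarith [hx.1]⟩
    simpa [angle_reflect hb, Real.sin_pi_div_two_sub] using this
  have hpos : ∀ t ∈ Icc (0 : ℝ) 1, ∃ A : ℝ, A = (2 * b / Real.pi) ^ 2 * t + t ^ 2 * α t ∧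
      1 - A = (2 * b / Real.pi) ^ 2 * (1 - t) + (1 - t) ^ 2 * β (1 - t) ∧
      (0 < t → 0 < A) ∧ (t < 1 → A < 1) := by
    intro t ht
    have hcont : ContinuousOn (fun x => Real.sin (Real.pi * x / (2 * b)) ^ 2) (Icc 0 b) := by
      fun_prop
    have hbb : Real.pi * b / (2 * b) = Real.pi / 2 := by field_simp
    -- Every `t` in `[0, 1]` is `sin² (πx/2b)` for some `x`, so positivity can be read off from `θ
    -- x`, with `A = sin² (θ x)`.
    obtain ⟨x, hx, rfl⟩ := intermediate_value_Icc hb.le hcont (by simpa [hbb] using ht)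
    have hx0 : x ≠ 0 → 0 < θ x := fun hne => by
      rcases eq_or_lt_of_le hx.2 with rfl | hxb
      · rw [h1]
        positivity
      · exact (hrange x ⟨lt_of_le_of_ne hx.1 hne.symm, hxb⟩).1
    have hxb : x ≠ b → θ x < Real.pi / 2 := fun hne => by
      rcases eq_or_lt_of_le hx.1 with rfl | hx0
      · rw [h0]
        positivity
      · exact (hrange x ⟨hx0, lt_of_le_of_ne hx.2 hne⟩).2
    have hle : 0 ≤ θ x ∧ θ x ≤ Real.pi / 2 := by
      constructor
      · rcases eq_or_ne x 0 with rfl | h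
        · exact h0.ge
        · exact (hx0 h).le
      · rcases eq_or_ne x b with rfl | h
        · exact h1.le
        · exact (hxb h).le
    refine ⟨Real.sin (θ x) ^ 2, hαe x hx, ?_, fun h => ?_, fun h => ?_⟩
    · rw [← Real.cos_sq', ← Real.cos_sq', hβe' x hx]
    · have : x ≠ 0 := by
        rintro rfl
        simp at h
      exact pow_pos (Real.sin_pos_of_pos_of_lt_pi (hx0 this) (by linarith [Real.pi_pos])) 2
    · have : x ≠ b := by
        rintro rfl
        simp [hbb] at h
      have hc := pow_pos (Real.cos_pos_of_mem_Ioo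
        ⟨by linarith [Real.pi_pos], hxb this⟩) 2
      linarith [Real.sin_sq_add_cos_sq (θ x)]
  obtain ⟨G, hG⟩ := exists_smoothMetricS3
    (contMDiff_toralForm ((2 * b / Real.pi) ^ 2) hα hβ)
    (fun p v w => by
      rw [toralForm_apply, toralForm_apply]
      ring)
    (fun p v hv => toralForm_pos (by positivity) hpos p hv)
  refine ⟨G, fun q hq v w => ?_⟩
  rw [hG, dCoe_mfderiv_joinCoord, dCoe_mfderiv_joinCoord]
  have hq' : q.1 ∈ Icc 0 b := ⟨hq.1.le, hq.2.le⟩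
  exact toralForm_joinCoord hb (hαe _ hq') (hβe' _ hq') v w

theorem proposition6 (b : ℝ) (hb : 0 < b) (θ : ℝ → ℝ)
    (hθ : ContDiffOn ℝ ∞ θ (Set.Icc 0 b))
    (hzero : {x ∈ Set.Icc 0 b | θ x = 0} = {0})
    (hpi : {x ∈ Set.Icc 0 b | θ x = Real.pi / 2} = {b}) :
    DefinesSmoothMetricS3 b θ ↔
      (derivWithin θ (Set.Icc 0 b) 0 = 1 ∧ derivWithin θ (Set.Icc 0 b) b = 1 ∧
        ∀ k : ℕ, 1 ≤ k →
          iteratedDerivWithin (2 * k) θ (Set.Icc 0 b) 0 = 0 ∧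
          iteratedDerivWithin (2 * k) θ (Set.Icc 0 b) b = 0) := by
  obtain ⟨h0, h1, hrange⟩ := angle_range hθ.continuousOn hzero hpi
  exact ⟨jets_of_definesSmoothMetricS3 hb h0 h1 hrange, fun ⟨hd0, hd1, hk⟩ =>
    definesSmoothMetricS3_of_jets hb hθ h0 h1 hrange hd0 hd1 hk⟩
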